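/- *Setting.* Let $F$ be a totally real number field of degree $d$, let $\overline{\mathbb Q}$ be an algebraic closure of $\mathbb Q$, let $p\neq q$ be prime numbers, and fix embeddings $\overline{\mathbb Q}\to{\mathbb C}_p$ and $\overline{\mathbb Q}\to{\mathbb C}$. For a locally compact totally disconnected ring $A$ let ${\mathcal S}(A,\overline{\mathbb Q})$ be the space of locally constant functions $A\to\overline{\mathbb Q}$ with compact support, and put $\|\phi\|_p=\max_{x\in A}|\phi(x)|_p$ for $\phi\in{\mathcal S}(A,\overline{\mathbb Q})$. Let ${\mathbf A}^{\infty}={\mathbf A}^{q,\infty}\times F_q$ be the ring of finite adeles of $F$, where ${\mathbf A}^{q,\infty}$ is the ring of finite adeles away from the places above $q$ and $F_q=\prod_{v\mid q}F_v$. Let ${\mathfrak q}$ be a prime of $F$ above $q$ with $\mathrm N({\mathfrak q})=q$. Let $\phi_{\mathfrak q}:F_{\mathfrak q}\to\overline{\mathbb Q}$ be $1$ on ${\mathcal O}_{\mathfrak q}^*$, $1-\mathrm N({\mathfrak q})$ on ${\mathfrak q}{\mathcal O}_{\mathfrak q}$ and $0$ elsewhere, and put $\phi_q=\phi_{\mathfrak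 q}\otimes\bigotimes_{v\mid q,\,v\neq{\mathfrak q}}1_{{\mathcal O}_v}\in{\mathcal S}(F_q,\overline{\mathbb Q})$. Let $E_{q,+}$ be the group of totally positive $x\in F^*$ with $\mathrm{ord}_v(x)=0$ for all $v\mid q$. For $m\ge 1$ and totally positive $x_1,\dots,x_m\in F$ that are linearly independent over ${\mathbb R}$ in $F_\infty=F\otimes{\mathbb R}$, the Shintani cone generated by $x_1,\dots,x_m$ is $C(x_1,\dots,x_m)=\{\sum_i\lambda_ix_i\mid\lambda_i\in{\mathbb R},\ \lambda_i>0\}\subset F_\infty$. Let ${\mathcal R}=\overline{\mathbb Q}[\![V]\!]=\prod_{n\ge0}\mathrm{Sym}^nV$ for $V=F\otimes_{\mathbb Q}\overline{\mathbb Q}$ (a power series ring in $d$ variables, after the choice of any basis of $V$), let $\mathrm{ev}_0:{\mathcal R}\to\overline{\mathbb Q}$ be the constant term, ${\mathcal Q}$ the quotient field of ${\mathcal R}$, and $\exp(x)=\sum_{n\ge0}\iota(x)^n/n!\in{\mathcal R}$ for $x\in F$, where $\iota:F\to V=\mathrm{Sym}^1V$ is the natural map. The Solomon–Hu pairing $\langle\!\langle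 f,\Phi\rangle\!\rangle\in{\mathcal Q}$, for $f$ in the ${\mathbb Z}$-span of the characteristic functions of Shintani cones and $\Phi\in{\mathcal S}({\mathbf A}^\infty,\overline{\mathbb Q})$, is the regularised value of the formal sum $\sum_{x\in F}f(x)\Phi(x)\exp(x)$: for a function $g:F\to\overline{\mathbb Q}$ and nonzero $y_1,\dots,y_n\in F$ such that $h=\prod_i(1-[y_i])\,g$ has finite support, where $((1-[y])g)(x)=g(x)-g(x-y)$, the value is $\prod_i(1-\exp(y_i))^{-1}\sum_{x}h(x)\exp(x)$, independently of the choice of the $y_i$. In particular, if $C=C(x_1,\dots,x_m)$ and $\Phi$ is invariant under translation by $\sum_i{\mathbb Z}x_i$, then $\langle\!\langle 1_C,\Phi\rangle\!\rangle=\prod_{i}(1-\exp(x_i))^{-1}\sum_{x}\Phi(x)\exp(x)$, with $x$ running through the elements of $F$ of the form $\sum_it_ix_i$, $0<t_i\le1$. For a Shintani cone $C$ put $L(\Phi,C;s)=\sum_{x\in F}\Phi(x)\,1_C(x)\,\mathrm N_{F/{\mathbb Q}}(x)^{-s}$. *Statement.* Let $\phi\in{\mathcal S}({\mathbf A}^{q,\infty},\overline{\mathbb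 Q})$ and let $C=C(x_1,\dots,x_m)$ be a Shintani cone generated by $x_1,\dots,x_m\in E_{q,+}$. (a) $\langle\!\langle1_C,\phi\otimes\phi_q\rangle\!\rangle\in{\mathcal R}$, and $|\mathrm{ev}_0(\langle\!\langle1_C,\phi\otimes\phi_q\rangle\!\rangle)|_p\le\|\phi\|_p$. (b) The series $L(\phi\otimes\phi_q,C;s)$ converges absolutely for $\mathrm{Re}(s)>m/d$ and extends to a holomorphic function on the whole complex plane, whose value at $s=0$ is $\mathrm{ev}_0(\langle\!\langle1_C,\phi\otimes\phi_q\rangle\!\rangle)$. -/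

import Mathlib

open NumberField IsDedekindDomain
open scoped TensorProduct RestrictedProduct

noncomputable section

namespace ConeZeta

/-! ### Cones in `F_∞ = F ⊗ ℝ = ℝ^d` -/

section Cones

variable (F : Type*) [Field F]

/-- `F_∞ = ∏_σ ℝ`, the product over all embeddings `σ : F → ℝ`. For a totally real field `F` of
degree `d` this is `F ⊗ ℝ ≅ ℝ^d`. -/
abbrev RealSpace : Type _ := (F →+* ℝ) → ℝ

variable {F}

/-- The embedding `F → F_∞`, `x ↦ (σ(x))_σ`. -/
def realEmb (x : F) : RealSpace F := fun σ => σ x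

/-- `x` is totally positive. -/
def TotallyPositive (x : F) : Prop := ∀ σ : F →+* ℝ, 0 < σ x

/-- The open cone `C(v_1, …, v_m) = {∑ λ_i v_i ∣ λ_i > 0}` in `F_∞`. -/
def cone {m : ℕ} (v : Fin m → RealSpace F) : Set (RealSpace F) :=
  {z | ∃ c : Fin m → ℝ, (∀ i, 0 < c i) ∧ z = ∑ i, c i • v i}

/-- The elements `x_1, …, x_m` of `F` (with `m ≥ 1`) are totally positive and their images in `F_∞`
are linearly independent over `ℝ`, so that they generate a Shintani cone. -/
structure GeneratesShintaniCone {m : ℕ} (x : Fin m → F) : Prop where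
  pos : 0 < m
  totallyPositive : ∀ i, TotallyPositive (x i)
  linearIndependent : LinearIndependent ℝ fun i => realEmb (x i)

/-- The Shintani cone `C(x_1, …, x_m) ⊆ F_∞` generated by elements of `F`. -/
def shintaniCone {m : ℕ} (x : Fin m → F) : Set (RealSpace F) := cone fun i => realEmb (x i)

end Cones

/-! ### Schwartz spaces and finite adeles -/

/-- The Schwartz space `S(A, R)`: locally constant functions `A → R` with compact support. -/
def schwartz (A R : Type*) [TopologicalSpace A] [CommRing R] : Submodule R (A → R) where
  carrier := {f | IsLocallyConstant f ∧ HasCompactSupport f}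
  zero_mem' := ⟨IsLocallyConstant.const 0, HasCompactSupport.zero⟩
  add_mem' hf hg := ⟨hf.1.add hg.1, hf.2.add hg.2⟩
  smul_mem' c f hf := ⟨hf.1.comp fun r => c * r,
    hf.2.mono fun x hx => by
      simp only [Function.mem_support, Pi.smul_apply, smul_eq_mul] at hx ⊢
      exact right_ne_zero_of_mul hx⟩

/-- The maximum norm `max_x |φ(x)|` of a function with values in a normed ring `K`, read through an
embedding `j`. (For a locally constant compactly supported function only finitely many values
occur, so that the supremum is a maximum.) -/
def maxNorm {A R K : Type*} [Semiring R] [NormedRing K] (j : R →+* K) (φ : A → R) : ℝ :=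
  ⨆ x, ‖j (φ x)‖

section Adeles

variable (F : Type*) [Field F] [NumberField F] (q : ℕ)

/-- The finite places of `F`, as the nonzero primes of `𝓞 F`. -/
abbrev FinPlace : Type _ := HeightOneSpectrum (𝓞 F)

variable {F} in
/-- The finite place `v` lies above `q`. -/
def Above (v : FinPlace F) : Prop := (q : 𝓞 F) ∈ v.asIdeal

/-- `A^{q,∞}`, the adeles away from `q` and `∞`: the restricted product of the completions `F_v`
with respect to the valuation rings `𝓞_v`, over the finite places `v` not above `q`. -/
abbrev AdelesAway : Type _ :=
  Πʳ v : {v : FinPlace F // ¬ Above q v}, [v.1.adicCompletion F, v.1.adicCompletionIntegers F]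

/-- `F_q = ∏_{v ∣ q} F_v`. -/
abbrev LocalAlgebra : Type _ := ∀ v : {v : FinPlace F // Above q v}, v.1.adicCompletion F

variable {F}

/-- The projection `A^∞ → A^{q,∞}`. -/
def awayPart (x : FiniteAdeleRing (𝓞 F) F) : AdelesAway F q :=
  ⟨fun v => x v.1, Subtype.val_injective.tendsto_cofinite.eventually x.2⟩

/-- The projection `A^∞ → F_q`. -/
def localPart (x : FiniteAdeleRing (𝓞 F) F) : LocalAlgebra F q := fun v => x v.1

/-- `x` belongs to `E_{q,+}`: it is a totally positive element of `F^*` with `ord_v(x) = 0` for all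
places `v` above `q`. -/
def MemEPlus (x : F) : Prop :=
  x ≠ 0 ∧ (∀ v : FinPlace F, Above q v → v.valuation F x = 1) ∧ TotallyPositive x

variable {q} {R : Type*} [CommRing R]

open Classical in
/-- The function `φ_𝔮` on `F_𝔮`: it is `1` on the units of `𝓞_𝔮`, it is `1 - N𝔮` on the maximal
ideal of `𝓞_𝔮`, and `0` elsewhere. -/
def phiPrime (R : Type*) [CommRing R] (𝔮 : FinPlace F) (x : 𝔮.adicCompletion F) : R :=
  if Valued.v x = 1 then 1
  else if Valued.v x < 1 then 1 - (Ideal.absNorm 𝔮.asIdeal : R)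
  else 0

open Classical in
/-- The function `φ_q = φ_𝔮 ⊗ ⨂_{v ∣ q, v ≠ 𝔮} 1_{𝓞_v}` on `F_q = ∏_{v ∣ q} F_v`, where `𝔮` is a
place above `q`. -/
def phiQ (R : Type*) [CommRing R] (𝔮 : {v : FinPlace F // Above q v}) (x : LocalAlgebra F q) : R :=
  if ∀ v, v ≠ 𝔮 → x v ∈ v.1.adicCompletionIntegers F then phiPrime R 𝔮.1 (x 𝔮) else 0

/-- The function `φ ⊗ ψ` on `A^∞ = A^{q,∞} × F_q`. -/
def tensor (φ : AdelesAway F q → R) (ψ : LocalAlgebra F q → R) :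
    FiniteAdeleRing (𝓞 F) F → R :=
  fun x => φ (awayPart q x) * ψ (localPart q x)

end Adeles

/-! ### The power series ring and the Solomon–Hu pairing

`Qbar` is an algebraic closure of `ℚ`. A basis `b` of the `Qbar`-vector space `V = F ⊗ Qbar`
identifies the completed symmetric algebra `Qbar[[V]] = ∏_n Sym^n V` with the ring of formal power
series in variables `z_k` indexed by the basis; this is how we represent it. The basis is
arbitrary throughout. -/

/-- The field of algebraic numbers. -/
abbrev Qbar : Type := AlgebraicClosure ℚ

section Pairing

section Translation

variable {F : Type*} [Field F]

/-- The operator `1 - [y]` on functions on `F`, where `[y]` is translation by `y`: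
`((1 - [y]) g)(x) = g(x) - g(x - y)`. -/
def diffOp (y : F) (g : F → Qbar) : F → Qbar := fun x => g x - g (x - y)

/-- The operator `1 - [y]` on finitely supported functions. -/
def diffFin (y : F) (h : F →₀ Qbar) : F →₀ Qbar := h - h.mapDomain (· + y)

theorem coe_diffFin (y : F) (h : F →₀ Qbar) : ⇑(diffFin y h) = diffOp y h := by
  ext x
  have := Finsupp.mapDomain_apply (add_left_injective y) h (x - y)
  simp only [sub_add_cancel] at this
  simp [diffFin, diffOp, this]

theorem diffOp_comm (y z : F) (g : F → Qbar) : diffOp y (diffOp z g) = diffOp z (diffOp y g) := by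
  ext x
  simp only [diffOp, sub_right_comm x y z]
  ring

theorem foldr_diffOp_comm (ys zs : List F) (g : F → Qbar) :
    ys.foldr diffOp (zs.foldr diffOp g) = zs.foldr diffOp (ys.foldr diffOp g) := by
  have key : ∀ (y : F) (l : List F) (g : F → Qbar),
      diffOp y (l.foldr diffOp g) = l.foldr diffOp (diffOp y g) := by
    intro y l g
    induction l with
    | nil => rfl
    | cons a l ih => rw [List.foldr_cons, diffOp_comm, ih, List.foldr_cons]
  induction ys with
  | nil => rfl
  | cons a l ih => rw [List.foldr_cons, ih, key, List.foldr_cons]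

theorem coe_foldr_diffFin (ys : List F) (h : F →₀ Qbar) :
    ⇑(ys.foldr diffFin h) = ys.foldr diffOp ⇑h := by
  induction ys with
  | nil => rfl
  | cons a l ih => rw [List.foldr_cons, coe_diffFin, ih, List.foldr_cons]

end Translation

variable {F : Type*} [Field F] [Algebra ℚ F] {κ : Type*}

/-- `𝓡 = Qbar[[V]]`, in the coordinates given by a basis of `V` indexed by `κ`. -/
abbrev SeriesRing (κ : Type*) : Type _ := MvPowerSeries κ Qbar

/-- `𝓠`, the quotient field of `𝓡`. -/
abbrev SeriesField (κ : Type*) : Type _ := FractionRing (SeriesRing κ)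

variable (b : Module.Basis κ Qbar (Qbar ⊗[ℚ] F))

/-- The embedding `ι : F → V = Sym^1 V ⊆ 𝓡`, `x ↦ 1 ⊗ x`: if `1 ⊗ x = ∑ c_k b_k`, then
`ι(x) = ∑ c_k z_k`. -/
def iota (x : F) : SeriesRing κ :=
  (b.repr (1 ⊗ₜ[ℚ] x)).sum fun k c => MvPowerSeries.C c * MvPowerSeries.X k

/-- `exp(x) = ∑_n ι(x)^n / n! ∈ 𝓡`. -/
def expSeries (x : F) : SeriesRing κ := (PowerSeries.exp Qbar).subst (iota b x)

/-- `z ∈ 𝓠` is the regularised value of the formal sum `∑_{x ∈ F} g(x) exp(x)`: for suitable nonzero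
`y_1, …, y_n ∈ F` the function `h = ∏_i (1 - [y_i]) g` has finite support, and
`∏_i (1 - exp(y_i)) · z = ∑_x h(x) exp(x)`. The value is unique, see `HasExpSum.unique`. -/
def HasExpSum (g : F → Qbar) (z : SeriesField κ) : Prop :=
  ∃ ys : List F, (∀ y ∈ ys, y ≠ 0) ∧ ∃ h : F →₀ Qbar, ys.foldr diffOp g = h ∧
    algebraMap (SeriesRing κ) (SeriesField κ) (ys.map fun y => 1 - expSeries b y).prod * z =
      algebraMap (SeriesRing κ) (SeriesField κ)
        (h.sum fun x c => MvPowerSeries.C c * expSeries b x)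


/-! #### Uniqueness -/

theorem constantCoeff_iota (x : F) : MvPowerSeries.constantCoeff (iota b x) = 0 := by
  simp [iota, Finsupp.sum, map_sum]

theorem one_le_order_iota (x : F) : 1 ≤ (iota b x).order :=
  MvPowerSeries.one_le_order_iff_constCoeff_eq_zero.2 (constantCoeff_iota b x)

theorem iota_add (x y : F) : iota b (x + y) = iota b x + iota b y := by
  simp only [iota, TensorProduct.tmul_add, map_add]
  exact Finsupp.sum_add_index' (by simp) (by intros; simp [add_mul])

/-- The power series of order at least `N`. -/
def orderIdeal (κ : Type*) (N : ℕ) : Ideal (SeriesRing κ) where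
  carrier := {f | (N : ℕ∞) ≤ f.order}
  zero_mem' := by simp
  add_mem' hf hg := (le_min hf hg).trans MvPowerSeries.min_order_le_add
  smul_mem' c f hf := by
    refine le_trans ?_ MvPowerSeries.le_order_mul
    exact le_trans hf le_add_self

theorem expSeries_sub_mem (x : F) (N : ℕ) :
    expSeries b x - ∑ d ∈ Finset.range N, ((d.factorial : ℚ)⁻¹) • iota b x ^ d
      ∈ orderIdeal κ N := by
  refine MvPowerSeries.le_order fun e he => ?_
  have hs : PowerSeries.HasSubst (iota b x) :=
    PowerSeries.HasSubst.of_constantCoeff_zero (constantCoeff_iota b x)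
  rw [map_sub, expSeries, PowerSeries.coeff_subst hs,
    finsum_eq_sum_of_support_subset (s := Finset.range N), map_sum, ← Finset.sum_sub_distrib]
  · refine Finset.sum_eq_zero fun d _ => ?_
    have : ((d.factorial : ℚ)⁻¹) • iota b x ^ d
        = (algebraMap ℚ Qbar (1 / d.factorial)) • iota b x ^ d := by
      rw [algebraMap_smul, one_div]
    rw [this]
    simp
  · intro d hd
    simp only [Function.mem_support] at hd
    by_contra hdN
    apply hd
    have : (e.degree : ℕ∞) < (iota b x ^ d).order := by
      refine lt_of_lt_of_le he ?_
      refine le_trans ?_ (MvPowerSeries.le_order_pow_of_constantCoeff_eq_zero d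
        (constantCoeff_iota b x))
      simpa using hdN
    rw [MvPowerSeries.coeff_of_lt_order this, smul_zero]

theorem mk_iota_pow (x : F) (N : ℕ) :
    (Ideal.Quotient.mk (orderIdeal κ N) (iota b x)) ^ N = 0 := by
  rw [← map_pow, Ideal.Quotient.eq_zero_iff_mem]
  exact MvPowerSeries.le_order_pow_of_constantCoeff_eq_zero N (constantCoeff_iota b x)

theorem mk_expSeries (x : F) (N : ℕ) :
    Ideal.Quotient.mk (orderIdeal κ N) (expSeries b x) =
      IsNilpotent.exp (Ideal.Quotient.mk (orderIdeal κ N) (iota b x)) := by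
  rw [IsNilpotent.exp_eq_sum (mk_iota_pow b x N),
    Ideal.Quotient.eq.2 (expSeries_sub_mem b x N), map_sum]
  refine Finset.sum_congr rfl fun d _ => ?_
  rw [← map_pow, ← Ideal.Quotient.mkₐ_eq_mk ℚ, map_smul]

theorem expSeries_add (x y : F) : expSeries b (x + y) = expSeries b x * expSeries b y := by
  ext e
  have h : Ideal.Quotient.mk (orderIdeal κ (e.degree + 1)) (expSeries b (x + y)) =
      Ideal.Quotient.mk (orderIdeal κ (e.degree + 1)) (expSeries b x * expSeries b y) := by
    rw [map_mul, mk_expSeries, mk_expSeries, mk_expSeries, iota_add, map_add,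
      IsNilpotent.exp_add_of_commute (Commute.all _ _) ⟨_, mk_iota_pow b x _⟩
        ⟨_, mk_iota_pow b y _⟩]
  have h2 : ((e.degree + 1 : ℕ) : ℕ∞) ≤
      (expSeries b (x + y) - expSeries b x * expSeries b y).order := Ideal.Quotient.eq.1 h
  have h3 := MvPowerSeries.coeff_of_lt_order (d := e)
    (f := expSeries b (x + y) - expSeries b x * expSeries b y)
    (lt_of_lt_of_le (by exact_mod_cast Nat.lt_succ_self _) h2)
  rwa [map_sub, sub_eq_zero] at h3

theorem coeff_iota (x : F) (k : κ) :
    MvPowerSeries.coeff (Finsupp.single k 1) (iota b x) = b.repr (1 ⊗ₜ[ℚ] x) k := by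
  classical
  simp only [iota, Finsupp.sum, map_sum, MvPowerSeries.coeff_C_mul, MvPowerSeries.coeff_X,
    Finsupp.single_left_inj (one_ne_zero : (1 : ℕ) ≠ 0)]
  rw [Finset.sum_eq_single k]
  · simp
  · intro j _ hj
    simp [hj.symm]
  · intro hk
    simpa using hk

theorem one_sub_expSeries_ne_zero {y : F} (hy : y ≠ 0) : 1 - expSeries b y ≠ 0 := by
  intro h
  have hinj : Function.Injective (Algebra.TensorProduct.includeRight : F →ₐ[ℚ] Qbar ⊗[ℚ] F) :=
    Algebra.TensorProduct.includeRight_injective (algebraMap ℚ Qbar).injective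
  have h1 : (1 : Qbar) ⊗ₜ[ℚ] y ≠ 0 := fun h0 => hy (hinj (by simpa using h0))
  apply h1
  apply b.repr.injective
  ext k
  have h2 : ((2 : ℕ) : ℕ∞) ≤ (expSeries b y - ∑ d ∈ Finset.range 2,
    ((d.factorial : ℚ)⁻¹) • iota b y ^ d).order := expSeries_sub_mem b y 2
  have h3 := MvPowerSeries.coeff_of_lt_order (d := Finsupp.single k 1)
    (lt_of_lt_of_le (by simp) h2)
  rw [← sub_eq_zero.1 h] at h3
  simpa [Finset.sum_range_succ, coeff_iota] using h3

/-- `∑_x h(x) exp(x)` for a finitely supported function `h`, as a linear map. -/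
def expSum : (F →₀ Qbar) →ₗ[Qbar] SeriesRing κ :=
  Finsupp.linearCombination Qbar (expSeries b)

theorem expSum_apply (h : F →₀ Qbar) :
    expSum b h = h.sum fun x c => MvPowerSeries.C c * expSeries b x := by
  simp [expSum, Finsupp.linearCombination_apply, MvPowerSeries.smul_eq_C_mul]

theorem expSum_diffFin (y : F) (h : F →₀ Qbar) :
    expSum b (diffFin y h) = (1 - expSeries b y) * expSum b h := by
  rw [diffFin, map_sub, sub_mul, one_mul, mul_comm, expSum, Finsupp.linearCombination_mapDomain]
  congr 1
  simp only [Finsupp.linearCombination_apply, Finsupp.sum, Function.comp_apply, expSeries_add,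
    Finset.sum_mul, smul_mul_assoc]

theorem expSum_foldr (ys : List F) (h : F →₀ Qbar) :
    expSum b (ys.foldr diffFin h) = (ys.map fun y => 1 - expSeries b y).prod * expSum b h := by
  induction ys with
  | nil => simp
  | cons a l ih => rw [List.foldr_cons, expSum_diffFin, ih, List.map_cons, List.prod_cons, mul_assoc]

theorem prod_ne_zero {ys : List F} (hys : ∀ y ∈ ys, y ≠ 0) :
    (ys.map fun y => 1 - expSeries b y).prod ≠ 0 := by
  rw [Ne, List.prod_eq_zero_iff]
  simp only [List.mem_map, not_exists, not_and]
  exact fun y hy => one_sub_expSeries_ne_zero b (hys y hy)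

/-- The regularised value of a formal sum does not depend on the choice of the `y_i`. -/
theorem HasExpSum.unique {g : F → Qbar} {z w : SeriesField κ} (hz : HasExpSum b g z)
    (hw : HasExpSum b g w) : z = w := by
  obtain ⟨ys, hys, h, hh, hzh⟩ := hz
  obtain ⟨zs, hzs, k, hk, hwk⟩ := hw
  rw [← expSum_apply] at hzh hwk
  have e : zs.foldr diffFin h = ys.foldr diffFin k := by
    apply DFunLike.coe_injective
    rw [coe_foldr_diffFin, coe_foldr_diffFin, ← hh, ← hk, foldr_diffOp_comm]
  have e2 := congrArg (fun t => algebraMap (SeriesRing κ) (SeriesField κ) (expSum b t)) e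
  simp only [expSum_foldr, map_mul, ← hzh, ← hwk] at e2
  have hy : algebraMap (SeriesRing κ) (SeriesField κ) _ ≠ 0 :=
    (map_ne_zero_iff _ (IsFractionRing.injective _ _)).2 (prod_ne_zero b hys)
  have hz : algebraMap (SeriesRing κ) (SeriesField κ) _ ≠ 0 :=
    (map_ne_zero_iff _ (IsFractionRing.injective _ _)).2 (prod_ne_zero b hzs)
  rw [mul_left_comm] at e2
  exact mul_left_cancel₀ hz (mul_left_cancel₀ hy e2)

end Pairing

section SolomonHu

variable {F : Type*} [Field F] [NumberField F] {κ : Type*}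
  (b : Module.Basis κ Qbar (Qbar ⊗[ℚ] F))

open Classical in
/-- The Solomon–Hu pairing `⟨⟨f, Φ⟩⟩ ∈ 𝓠` of a `ℤ`-linear combination `f` of characteristic
functions of Shintani cones in `F_∞` and a function `Φ ∈ S(A^∞, Qbar)`: the regularised value of
`∑_{x ∈ F} f(x) Φ(x) exp(x)`. (The value is `0` by convention for pairs of functions for which the
regularised value does not exist.) -/
def solomonHu (f : RealSpace F → ℤ) (Φ : FiniteAdeleRing (𝓞 F) F → Qbar) : SeriesField κ :=
  if h : ∃ z, HasExpSum b (fun x => (f (realEmb x) : Qbar) * Φ (algebraMap F _ x)) z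
  then h.choose else 0

theorem solomonHu_eq {f : RealSpace F → ℤ} {Φ : FiniteAdeleRing (𝓞 F) F → Qbar}
    {z : SeriesField κ}
    (h : HasExpSum b (fun x => (f (realEmb x) : Qbar) * Φ (algebraMap F _ x)) z) :
    solomonHu b f Φ = z := by
  have h' : ∃ z, HasExpSum b (fun x => (f (realEmb x) : Qbar) * Φ (algebraMap F _ x)) z := ⟨z, h⟩
  rw [solomonHu, dif_pos h']
  exact h'.choose_spec.unique b h

/-- The set of all `∑ t_i x_i` with `t_i > 0` for all `i`, and `t_i ≤ 1` for `i ∈ J`. For `J` the set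
of all indices it is the half-open parallelepiped `P(x_1, …, x_m)`. -/
def halfOpenCell {m : ℕ} (x : Fin m → F) (J : Set (Fin m)) : Set (RealSpace F) :=
  {z | ∃ c : Fin m → ℝ, (∀ i, 0 < c i) ∧ (∀ i ∈ J, c i ≤ 1) ∧ z = ∑ i, c i • realEmb (x i)}

open Classical in
theorem diffOp_indicator {m : ℕ} {x : Fin m → F} (hx : LinearIndependent ℝ fun i => realEmb (x i))
    (J : Set (Fin m)) (i : Fin m) (hi : i ∉ J) (g : F → Qbar) (hg : ∀ y, g (y - x i) = g y) :
    diffOp (x i) (fun y => if realEmb y ∈ halfOpenCell x J then g y else 0) =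
      fun y => if realEmb y ∈ halfOpenCell x (insert i J) then g y else 0 := by
  ext y
  simp only [diffOp, hg]
  have hsub : realEmb (y - x i) = realEmb y - realEmb (x i) := by ext; simp [realEmb]
  have huniq : ∀ c c' : Fin m → ℝ, ∑ i, c i • realEmb (x i) = ∑ i, c' i • realEmb (x i) → c = c' :=
    fun c c' h => by
      ext j
      have := Fintype.linearIndependent_iff.1 hx (fun i => c i - c' i)
        (by simp [sub_smul, Finset.sum_sub_distrib, h]) j
      linarith
  have hsum : ∀ c : Fin m → ℝ, ∑ j, (c j + if j = i then 1 else 0) • realEmb (x j) =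
      ∑ j, c j • realEmb (x j) + realEmb (x i) := fun c => by
    simp [add_smul, Finset.sum_add_distrib, ite_smul]
  by_cases h1 : realEmb y ∈ halfOpenCell x J
  · obtain ⟨c, hc, hcJ, hy⟩ := id h1
    by_cases h2 : c i ≤ 1
    · have h3 : realEmb y ∈ halfOpenCell x (insert i J) :=
        ⟨c, hc, fun j hj => hj.elim (fun h => h ▸ h2) (hcJ j), hy⟩
      have h4 : ¬ realEmb (y - x i) ∈ halfOpenCell x J := by
        rintro ⟨d, hd, -, hyd⟩
        rw [hsub, hy, sub_eq_iff_eq_add, ← hsum d] at hyd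
        have := congrFun (huniq _ _ hyd) i
        simp at this
        linarith [hd i]
      simp [h1, h3, h4]
    · have h3 : ¬ realEmb y ∈ halfOpenCell x (insert i J) := by
        rintro ⟨d, hd, hdJ, hyd⟩
        rw [hy] at hyd
        rw [huniq _ _ hyd] at h2
        exact h2 (hdJ i (Set.mem_insert _ _))
      have h4 : realEmb (y - x i) ∈ halfOpenCell x J := by
        refine ⟨fun j => c j - if j = i then 1 else 0, ?_, ?_, ?_⟩
        · intro j
          by_cases hj : j = i
          · subst hj; simp; linarith
          · simp [hj, hc j]
        · intro j hj
          have : j ≠ i := fun h => hi (h ▸ hj)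
          simp [this, hcJ j hj]
        · rw [hsub, hy, sub_eq_iff_eq_add, ← hsum]
          simp
      simp [h1, h3, h4]
  · have h3 : ¬ realEmb y ∈ halfOpenCell x (insert i J) := by
      rintro ⟨d, hd, hdJ, hyd⟩
      exact h1 ⟨d, hd, fun j hj => hdJ j (Set.mem_insert_of_mem _ hj), hyd⟩
    have h4 : ¬ realEmb (y - x i) ∈ halfOpenCell x J := by
      rintro ⟨d, hd, hdJ, hyd⟩
      rw [hsub, sub_eq_iff_eq_add, ← hsum d] at hyd
      refine h1 ⟨_, ?_, ?_, hyd⟩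
      · intro j
        have := hd j
        positivity
      · intro j hj
        have : j ≠ i := fun h => hi (h ▸ hj)
        simp [this, hdJ j hj]
    simp [h1, h3, h4]

open Classical in
theorem foldr_diffOp_indicator {m : ℕ} {x : Fin m → F} (hx : LinearIndependent ℝ fun i => realEmb (x i))
    (g : F → Qbar) (hg : ∀ i y, g (y - x i) = g y) (l : List (Fin m)) (hl : l.Nodup) :
    (l.map x).foldr diffOp (fun y => if realEmb y ∈ shintaniCone x then g y else 0) =
      fun y => if realEmb y ∈ halfOpenCell x {i | i ∈ l} then g y else 0 := by
  induction l with
  | nil => simp [shintaniCone, cone, halfOpenCell]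
  | cons a l ih =>
    rw [List.map_cons, List.foldr_cons, ih (List.nodup_cons.1 hl).2,
      diffOp_indicator hx _ a (by simpa using (List.nodup_cons.1 hl).1) g (hg a)]
    have : {i | i ∈ a :: l} = insert a {i | i ∈ l} := by ext; simp
    rw [this]

open Classical in
/-- The characteristic property of the pairing: if `Φ` is invariant under translation by the `x_i`,
and `h` is the restriction of `Φ` to `F ∩ P(x_1, …, x_m)`, then
`⟨⟨1_C, Φ⟩⟩ = ∏_i (1 - exp(x_i))⁻¹ ∑_x h(x) exp(x)` for `C = C(x_1, …, x_m)`. -/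
theorem solomonHu_cone {m : ℕ} {x : Fin m → F} (hx0 : ∀ i, x i ≠ 0)
    (hx : LinearIndependent ℝ fun i => realEmb (x i))
    (Φ : FiniteAdeleRing (𝓞 F) F → Qbar)
    (hΦ : ∀ i y, Φ (y - algebraMap F _ (x i)) = Φ y)
    (h : F →₀ Qbar)
    (hh : ∀ y, h y = if realEmb y ∈ halfOpenCell x Set.univ then Φ (algebraMap F _ y) else 0) :
    solomonHu b (Set.indicator (shintaniCone x) 1) Φ =
      (algebraMap (SeriesRing κ) (SeriesField κ) (∏ i, (1 - expSeries b (x i))))⁻¹ *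
      algebraMap (SeriesRing κ) (SeriesField κ)
        (h.sum fun x c => MvPowerSeries.C c * expSeries b x) := by
  apply solomonHu_eq
  have e := foldr_diffOp_indicator hx (fun y => Φ (algebraMap F _ y)) (fun i y => by simp [map_sub, hΦ])
    (List.finRange m) (List.nodup_finRange m)
  have hp : ((List.map x (List.finRange m)).map fun y => 1 - expSeries b y).prod =
      ∏ i, (1 - expSeries b (x i)) := by
    rw [List.map_map, ← List.ofFn_eq_map, List.prod_ofFn]; rfl
  refine ⟨(List.finRange m).map x, by simpa using hx0, h, ?_, ?_⟩
  · have e0 : (fun y => ((Set.indicator (shintaniCone x) 1 (realEmb y) : ℤ) : Qbar) *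
        Φ (algebraMap F _ y)) =
        fun y => if realEmb y ∈ shintaniCone x then Φ (algebraMap F _ y) else 0 := by
      ext y
      by_cases hy : realEmb y ∈ shintaniCone x <;> simp [hy]
    rw [e0, e]
    ext y
    rw [hh]
    simp
  · rw [hp, mul_inv_cancel_left₀]
    rw [← hp]
    exact (map_ne_zero_iff _ (IsFractionRing.injective _ _)).2 (prod_ne_zero b (by simpa using hx0))

end SolomonHu

open Classical in
/-- The term `Φ(x) 1_C(x) N(x)^{-s}` of the Dirichlet series `L(Φ, C; s)`, for `x ∈ F`, where the
algebraic number `Φ(x)` is read in `ℂ` through an embedding `j`. -/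
def coneTerm {F : Type*} [Field F] [NumberField F] (j : Qbar →+* ℂ)
    (Φ : FiniteAdeleRing (𝓞 F) F → Qbar) (C : Set (RealSpace F)) (s : ℂ) (x : F) : ℂ :=
  j (Φ (algebraMap F _ x)) * (if realEmb x ∈ C then 1 else 0) *
    ((Algebra.norm ℚ x : ℚ) : ℂ) ^ (-s)

end ConeZeta

end

open ConeZeta

noncomputable section

namespace ConeZeta

/-! ### Symbols on `ℕ^m` and Abel summation -/

section Symbols

variable {m : ℕ}

/-! On elements of `F` integral above `q`, the factor at `𝔮` depends only on the residue `r` modulo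
`𝔮`, and it equals `1 - q · 1_{r = 0}`. By orthogonality this is `-∑_{k ≠ 0} ψ(k r)` for a primitive
additive character `ψ` of `ZMod q`: the trivial character does not occur (`tensor_phiQ_eq_sum`).
Choose `M` prime to `q` such that `φ` is invariant under translation by `z_i = M x_i`
(`exists_coprime_forall_add_eq`). Each summand `g_k` then satisfies `g_k(y + z_i) = c_i g_k(y)` with
`c_i = ψ(k res(z_i))`, a `q`-th root of unity, and `c_i ≠ 1` because `z_i` is a unit at `𝔮`.

The cone is the disjoint union of the translates of a half-open cell by `∑ n_i z_i`, `n_i ≥ 0`, and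
`g_k` is nonzero at only finitely many points of `F` in that cell. Summing geometric series, the
regularised value for `g_k` is `∑_y g_k(y) exp(y) · ∏_i (1 - c_i exp(z_i))⁻¹`
(`exists_foldr_diffOp_eq`). The denominators have constant terms `1 - c_i ≠ 0`, so this is a power
series, with constant term `∑_y g_k(y) · ∏_i (1 - c_i)⁻¹`. Since `q ≠ p`, each `1 - c_i` has
`p`-adic inverse of norm at most `1` (`norm_inv_one_sub_le_one`), and the ultrametric inequality
gives the bound.

Analytically, the same decomposition expresses the Dirichlet series through finitely many sums `∑_n
∏ ξ_i^{n_i} ∏_σ ℓ_σ(n)^{-s}` with `ξ_i ≠ 1` and affine forms `ℓ_σ` with positive coefficients.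
Repeated summation by parts replaces the terms by their differences, each of which lowers the order
of growth by one, so the sum continues to every ball around `0` and hence to the plane
(`exists_abelSum`, `exists_entire_shintani`). At `s = 0` the terms are constant and all differences
vanish. Only the boundary contributions survive, giving `∏ (1 - ξ_i)⁻¹`, the same number as in the
formal computation. -/

/-- The size `1 + |n|` of a multi-index. -/
def size (n : Fin m → ℕ) : ℝ := 1 + ∑ i, (n i : ℝ)

theorem one_le_size (n : Fin m → ℕ) : 1 ≤ size n := by
  unfold size
  linarith [Finset.sum_nonneg fun i (_ : i ∈ Finset.univ) => (Nat.cast_nonneg (n i) : (0 : ℝ) ≤ n i)]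

theorem size_pos (n : Fin m → ℕ) : 0 < size n := zero_lt_one.trans_le (one_le_size n)

theorem size_cons (a : ℕ) (n : Fin m → ℕ) : size (Fin.cons a n : Fin (m + 1) → ℕ) = a + size n := by
  simp only [size, Fin.sum_univ_succ, Fin.cons_zero, Fin.cons_succ]
  ring

/-- The forward difference in the `i`-th direction. -/
def fdiff (i : Fin m) (u : ℂ → (Fin m → ℕ) → ℂ) : ℂ → (Fin m → ℕ) → ℂ :=
  fun s n => u s (n + Pi.single i 1) - u s n

/-- Differences of `u` of order at most `k` are bounded like those of a symbol of order `B`,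
uniformly in the parameter `s ∈ U`. -/
def SymbolBound (U : Set ℂ) : ℕ → ℤ → (ℂ → (Fin m → ℕ) → ℂ) → Prop
  | 0, B, u => ∃ C, ∀ s ∈ U, ∀ n, ‖u s n‖ ≤ C * size n ^ B
  | k + 1, B, u => (∃ C, ∀ s ∈ U, ∀ n, ‖u s n‖ ≤ C * size n ^ B) ∧
      ∀ i, SymbolBound U k (B - 1) (fdiff i u)

/-- `u` is a symbol of order `B` on `ℕ^m`, uniformly in the parameter `s ∈ U`. -/
def IsSymbol (U : Set ℂ) (B : ℤ) (u : ℂ → (Fin m → ℕ) → ℂ) : Prop := ∀ k, SymbolBound U k B u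

variable {U : Set ℂ} {B B' : ℤ} {u v : ℂ → (Fin m → ℕ) → ℂ} {k : ℕ}

theorem SymbolBound.bound (h : SymbolBound U k B u) :
    ∃ C, 0 ≤ C ∧ ∀ s ∈ U, ∀ n, ‖u s n‖ ≤ C * size n ^ B := by
  have : ∃ C, ∀ s ∈ U, ∀ n, ‖u s n‖ ≤ C * size n ^ B := by
    cases k with
    | zero => exact h
    | succ k => exact h.1
  obtain ⟨C, hC⟩ := this
  refine ⟨max C 0, le_max_right _ _, fun s hs n => (hC s hs n).trans ?_⟩
  have := zpow_nonneg (size_pos n).le B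
  gcongr
  exact le_max_left _ _

theorem IsSymbol.bound (h : IsSymbol U B u) :
    ∃ C, 0 ≤ C ∧ ∀ s ∈ U, ∀ n, ‖u s n‖ ≤ C * size n ^ B := (h 0).bound

theorem IsSymbol.fdiff (h : IsSymbol U B u) (i : Fin m) : IsSymbol U (B - 1) (fdiff i u) :=
  fun k => (h (k + 1)).2 i

theorem SymbolBound.mono (hB : B ≤ B') (h : SymbolBound U k B u) : SymbolBound U k B' u := by
  induction k generalizing u B B' with
  | zero =>
    obtain ⟨C, hC0, hC⟩ := h.bound
    exact ⟨C, fun s hs n => (hC s hs n).trans (by gcongr; exact one_le_size n)⟩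
  | succ k ih =>
    obtain ⟨C, hC0, hC⟩ := h.bound
    exact ⟨⟨C, fun s hs n => (hC s hs n).trans (by gcongr; exact one_le_size n)⟩,
      fun i => ih (by omega) (h.2 i)⟩

theorem IsSymbol.mono (hB : B ≤ B') (h : IsSymbol U B u) : IsSymbol U B' u :=
  fun k => (h k).mono hB

/-- Agreement is asked only on `U` because identities between infinite sums are available only for
parameters where these converge. -/
theorem SymbolBound.congr (h : SymbolBound U k B u) (e : ∀ s ∈ U, ∀ n, v s n = u s n) :
    SymbolBound U k B v := by
  induction k generalizing u v B with
  | zero =>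
    obtain ⟨C, hC⟩ := h
    exact ⟨C, fun s hs n => by rw [e s hs n]; exact hC s hs n⟩
  | succ k ih =>
    obtain ⟨⟨C, hC⟩, h⟩ := h
    refine ⟨⟨C, fun s hs n => by rw [e s hs n]; exact hC s hs n⟩, fun j => ?_⟩
    refine ih (h j) fun s hs n => ?_
    simp only [ConeZeta.fdiff, e s hs]

theorem fdiff_add (i : Fin m) (u v : ℂ → (Fin m → ℕ) → ℂ) :
    fdiff i (u + v) = fdiff i u + fdiff i v := by
  ext s n
  simp only [fdiff, Pi.add_apply]
  ring

theorem SymbolBound.add (h : SymbolBound U k B u) (h' : SymbolBound U k B v) :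
    SymbolBound U k B (u + v) := by
  have key : ∃ C, ∀ s ∈ U, ∀ n, ‖(u + v) s n‖ ≤ C * size n ^ B := by
    obtain ⟨C, hC0, hC⟩ := h.bound
    obtain ⟨D, hD0, hD⟩ := h'.bound
    exact ⟨C + D, fun s hs n => (norm_add_le _ _).trans (by
      rw [add_mul]; exact add_le_add (hC s hs n) (hD s hs n))⟩
  induction k generalizing u v B with
  | zero => exact key
  | succ k ih =>
    refine ⟨key, fun i => ?_⟩
    rw [fdiff_add]
    refine ih (h.2 i) (h'.2 i) ?_
    obtain ⟨C, hC0, hC⟩ := (h.2 i).bound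
    obtain ⟨D, hD0, hD⟩ := (h'.2 i).bound
    exact ⟨C + D, fun s hs n => (norm_add_le _ _).trans (by
      rw [add_mul]; exact add_le_add (hC s hs n) (hD s hs n))⟩

/-- The shift in the `i`-th direction. -/
def shift (i : Fin m) (u : ℂ → (Fin m → ℕ) → ℂ) : ℂ → (Fin m → ℕ) → ℂ :=
  fun s n => u s (n + Pi.single i 1)

/-- The shift is the identity plus a difference, and the difference has even smaller order; sizes at
neighbouring points need not be compared. -/
theorem IsSymbol.shift (h : IsSymbol U B u) (i : Fin m) : IsSymbol U B (shift i u) := by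
  have : ConeZeta.shift i u = u + ConeZeta.fdiff i u := by
    ext s n
    simp [ConeZeta.shift, ConeZeta.fdiff]
  rw [this]
  exact fun k => (h k).add (((h.fdiff i) k).mono (by omega))

theorem fdiff_mul (i : Fin m) (u v : ℂ → (Fin m → ℕ) → ℂ) :
    fdiff i (u * v) = fdiff i u * shift i v + u * fdiff i v := by
  ext s n
  simp only [fdiff, shift, Pi.add_apply, Pi.mul_apply]
  ring

/-- By the discrete Leibniz rule `fdiff_mul`, a difference of the product is a sum of two products
of total order `B + B' - 1`. The induction on the number of differences keeps full symbols as
hypotheses, so that it applies to shifts and differences of the factors. -/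
theorem IsSymbol.mul (h : IsSymbol U B u) (h' : IsSymbol U B' v) : IsSymbol U (B + B') (u * v) := by
  intro k
  induction k generalizing u v B B' with
  | zero =>
    obtain ⟨C, hC0, hC⟩ := h.bound
    obtain ⟨D, hD0, hD⟩ := h'.bound
    refine ⟨C * D, fun s hs n => ?_⟩
    rw [zpow_add₀ (size_pos n).ne', Pi.mul_apply, Pi.mul_apply, norm_mul, mul_mul_mul_comm]
    have := zpow_nonneg (size_pos n).le B
    exact mul_le_mul (hC s hs n) (hD s hs n) (norm_nonneg _) (by positivity)
  | succ k ih =>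
    refine ⟨?_, fun i => ?_⟩
    · obtain ⟨C, -, hC⟩ := (ih h h').bound
      exact ⟨C, hC⟩
    · rw [fdiff_mul]
      refine SymbolBound.add ?_ ?_
      · convert ih (h.fdiff i) (h'.shift i) using 1
        ring
      · convert ih h (h'.fdiff i) using 1
        ring

theorem fdiff_const (i : Fin m) (c : ℂ) : fdiff i (fun _ _ => c) = fun _ _ => 0 := by
  ext s n
  simp [fdiff]

theorem isSymbol_zero (B : ℤ) : IsSymbol U B (fun _ (_ : Fin m → ℕ) => 0) := by
  have key (B : ℤ) : ∃ C, ∀ s ∈ U, ∀ n : Fin m → ℕ, ‖(0 : ℂ)‖ ≤ C * size n ^ B :=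
    ⟨0, fun s _ n => by simp⟩
  intro k
  induction k generalizing B with
  | zero => exact key B
  | succ k ih => exact ⟨key B, fun i => by rw [fdiff_const]; exact ih _⟩

theorem isSymbol_one : IsSymbol U 0 (1 : ℂ → (Fin m → ℕ) → ℂ) := by
  have key : ∃ C, ∀ s ∈ U, ∀ n : Fin m → ℕ, ‖(1 : ℂ)‖ ≤ C * size n ^ (0 : ℤ) :=
    ⟨1, fun s _ n => by simp⟩
  intro k
  cases k with
  | zero => exact key
  | succ k => exact ⟨key, fun i => by
      have := fdiff_const i 1
      simpa [Pi.one_def] using! (this ▸ isSymbol_zero (-1) k)⟩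

theorem isSymbol_prod {ι : Type*} (S : Finset ι) (A : ℤ) (w : ι → ℂ → (Fin m → ℕ) → ℂ)
    (hw : ∀ i ∈ S, IsSymbol U A (w i)) : IsSymbol U (S.card * A) (∏ i ∈ S, w i) := by
  classical
  induction S using Finset.induction_on with
  | empty => simpa using isSymbol_one
  | insert a S ha ih =>
    rw [Finset.prod_insert ha, Finset.card_insert_of_notMem ha]
    convert (hw a (by simp)).mul (ih fun i hi => hw i (by simp [hi])) using 1
    push_cast
    ring

theorem cons_add_single_succ (a : ℕ) (n : Fin m → ℕ) (i : Fin m) :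
    (Fin.cons a n : Fin (m + 1) → ℕ) + Pi.single i.succ 1 = Fin.cons a (n + Pi.single i 1) := by
  ext j
  refine Fin.cases ?_ (fun j => ?_) j
  · simp [(Fin.succ_ne_zero i).symm]
  · simp [Pi.single_apply]

theorem cons_add_single_zero (a : ℕ) (n : Fin m → ℕ) :
    (Fin.cons a n : Fin (m + 1) → ℕ) + Pi.single 0 1 = Fin.cons (a + 1) n := by
  ext j
  refine Fin.cases ?_ (fun j => ?_) j
  · simp
  · simp

theorem SymbolBound.cons_zero {u : ℂ → (Fin (m + 1) → ℕ) → ℂ} (h : SymbolBound U k B u) :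
    SymbolBound U k B (fun s n => u s (Fin.cons 0 n)) := by
  have key (B : ℤ) (u : ℂ → (Fin (m + 1) → ℕ) → ℂ)
      (h : ∃ C, 0 ≤ C ∧ ∀ s ∈ U, ∀ n, ‖u s n‖ ≤ C * size n ^ B) :
      ∃ C, ∀ s ∈ U, ∀ n : Fin m → ℕ, ‖u s (Fin.cons 0 n)‖ ≤ C * size n ^ B := by
    obtain ⟨C, hC0, hC⟩ := h
    exact ⟨C, fun s hs n => by simpa [size_cons] using hC s hs (Fin.cons 0 n)⟩
  induction k generalizing u B with
  | zero => exact key B u h.bound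
  | succ k ih =>
    refine ⟨key B u h.bound, fun i => ?_⟩
    have : fdiff i (fun s n => u s (Fin.cons 0 n)) = fun s n => fdiff i.succ u s (Fin.cons 0 n) := by
      ext s n
      simp only [fdiff, cons_add_single_succ]
    rw [this]
    exact ih (h.2 i.succ)

theorem norm_pow_mul_le {ξ : ℂ} (hξ : ‖ξ‖ ≤ 1) (a : ℕ) (z : ℂ) : ‖ξ ^ a * z‖ ≤ ‖z‖ := by
  rw [norm_mul, norm_pow]
  exact mul_le_of_le_one_left (norm_nonneg _) (pow_le_one₀ (norm_nonneg _) hξ)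

/-- Two powers of the size are spent on summability in the first coordinate, and the rest is bounded
through the remaining ones. The exponent `B + 2` is not optimal, but only the finiteness of the
resulting order matters. -/
theorem size_cons_zpow_le (hB : B ≤ -2) (a : ℕ) (n : Fin m → ℕ) :
    size (Fin.cons a n : Fin (m + 1) → ℕ) ^ B ≤ 1 / ((a : ℝ) + 1) ^ 2 * size n ^ (B + 2) := by
  have h1 := one_le_size n
  have ha : (0 : ℝ) ≤ a := Nat.cast_nonneg a
  have e : B = -2 + (B + 2) := by ring
  have hs := size_pos (Fin.cons a n : Fin (m + 1) → ℕ)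
  rw [e, zpow_add₀ hs.ne', ← e]
  have hle : size n ≤ size (Fin.cons a n : Fin (m + 1) → ℕ) := by rw [size_cons]; linarith
  have h2 : size (Fin.cons a n : Fin (m + 1) → ℕ) ^ (B + 2) ≤ size n ^ (B + 2) := by
    obtain ⟨c, hc⟩ : ∃ c : ℕ, B + 2 = -c := ⟨(-(B + 2)).toNat, by omega⟩
    rw [hc, zpow_neg, zpow_neg, zpow_natCast, zpow_natCast]
    have := size_pos n
    gcongr
  have h3 : size (Fin.cons a n : Fin (m + 1) → ℕ) ^ (-2 : ℤ) ≤ 1 / ((a : ℝ) + 1) ^ 2 := by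
    rw [one_div]
    have : ((a : ℝ) + 1) ≤ size (Fin.cons a n : Fin (m + 1) → ℕ) := by rw [size_cons]; linarith
    rw [show (-2 : ℤ) = -((2 : ℕ) : ℤ) by rfl, zpow_neg, zpow_natCast]
    gcongr
  exact mul_le_mul h3 h2 (zpow_nonneg hs.le _) (by positivity)

theorem summable_one_div_succ_sq : Summable fun a : ℕ => 1 / ((a : ℝ) + 1) ^ 2 := by
  have := (summable_nat_add_iff 1).2 (Real.summable_one_div_nat_pow.2 (one_lt_two))
  simpa using this

theorem summable_cons {u : ℂ → (Fin (m + 1) → ℕ) → ℂ} (hB : B ≤ -2) (h : SymbolBound U k B u)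
    {s : ℂ} (hs : s ∈ U) (n : Fin m → ℕ) : Summable fun a : ℕ => ‖u s (Fin.cons a n)‖ := by
  obtain ⟨C, hC0, hC⟩ := h.bound
  refine Summable.of_nonneg_of_le (fun _ => norm_nonneg _) (fun a => ?_)
    (summable_one_div_succ_sq.mul_left (C * size n ^ (B + 2)))
  refine (hC s hs _).trans ?_
  rw [mul_assoc, mul_comm (size n ^ _)]
  gcongr
  exact size_cons_zpow_le hB a n

theorem summable_pow_mul_cons {u : ℂ → (Fin (m + 1) → ℕ) → ℂ} (hB : B ≤ -2)
    (h : SymbolBound U k B u) {ξ : ℂ} (hξ : ‖ξ‖ ≤ 1)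
    {s : ℂ} (hs : s ∈ U) (n : Fin m → ℕ) : Summable fun a : ℕ => ξ ^ a * u s (Fin.cons a n) :=
  Summable.of_norm_bounded (summable_cons hB h hs n) fun a => norm_pow_mul_le hξ a _

/-- Differences in the remaining directions pass under the absolutely convergent sum, so the size
estimate applies to each of them. -/
theorem SymbolBound.tsum_cons {u : ℂ → (Fin (m + 1) → ℕ) → ℂ} {ξ : ℂ} (hξ : ‖ξ‖ ≤ 1) (hB : B ≤ -2)
    (h : SymbolBound U k B u) :
    SymbolBound U k (B + 2) (fun s n => ∑' a : ℕ, ξ ^ a * u s (Fin.cons a n)) := by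
  have key (B : ℤ) (hB : B ≤ -2) (u : ℂ → (Fin (m + 1) → ℕ) → ℂ)
      (h : ∃ C, 0 ≤ C ∧ ∀ s ∈ U, ∀ n, ‖u s n‖ ≤ C * size n ^ B) :
      ∃ C, ∀ s ∈ U, ∀ n : Fin m → ℕ,
        ‖∑' a : ℕ, ξ ^ a * u s (Fin.cons a n)‖ ≤ C * size n ^ (B + 2) := by
    obtain ⟨C, hC0, hC⟩ := h
    refine ⟨C * ∑' a : ℕ, 1 / ((a : ℝ) + 1) ^ 2, fun s hs n => ?_⟩
    have := (summable_one_div_succ_sq.mul_left (C * size n ^ (B + 2))).hasSum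
    rw [tsum_mul_left] at this
    refine (tsum_of_norm_bounded this fun a => (norm_pow_mul_le hξ a _).trans
      ((hC s hs _).trans ?_)).trans (le_of_eq (by ring))
    rw [mul_assoc, mul_comm (size n ^ _)]
    gcongr
    exact size_cons_zpow_le hB a n
  induction k generalizing u B with
  | zero => exact key B hB u h.bound
  | succ k ih =>
    refine ⟨key B hB u h.bound, fun i => ?_⟩
    rw [show B + 2 - 1 = B - 1 + 2 by ring]
    have hk : SymbolBound U k (B - 1 + 2)
        (fun s n => ∑' a : ℕ, ξ ^ a * fdiff i.succ u s (Fin.cons a n)) :=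
      ih (by omega) (h.2 i.succ)
    have e : ∀ s ∈ U, ∀ n, fdiff i (fun s n => ∑' a : ℕ, ξ ^ a * u s (Fin.cons a n)) s n =
        ∑' a : ℕ, ξ ^ a * fdiff i.succ u s (Fin.cons a n) := by
      intro s hs n
      simp only [fdiff, cons_add_single_succ, mul_sub]
      rw [Summable.tsum_sub (summable_pow_mul_cons hB h hξ hs _)
        (summable_pow_mul_cons hB h hξ hs _)]
    exact hk.congr e

/-! ### Rearrangement of twisted multiple sums. -/

theorem summable_weight_mul {ξ : Fin m → ℂ} (hξ : ∀ i, ‖ξ i‖ ≤ 1) {w : (Fin m → ℕ) → ℂ}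
    (hw : Summable fun n => ‖w n‖) : Summable fun n => (∏ i, ξ i ^ n i) * w n := by
  refine Summable.of_norm_bounded hw fun n => ?_
  rw [norm_mul, norm_prod]
  refine mul_le_of_le_one_left (norm_nonneg _) (Finset.prod_le_one (fun _ _ => norm_nonneg _) ?_)
  intro i _
  rw [norm_pow]
  exact pow_le_one₀ (norm_nonneg _) (hξ i)

/-- Splitting off the first coordinate of a multi-index. -/
def consProdEquiv (m : ℕ) : ℕ × (Fin m → ℕ) ≃ (Fin (m + 1) → ℕ) := Fin.consEquiv fun _ => ℕ

theorem consProdEquiv_apply (a : ℕ) (n : Fin m → ℕ) : consProdEquiv m (a, n) = Fin.cons a n := rfl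

theorem prod_pow_cons (ξ : Fin (m + 1) → ℂ) (a : ℕ) (n : Fin m → ℕ) :
    ∏ i, ξ i ^ (Fin.cons a n : Fin (m + 1) → ℕ) i = ξ 0 ^ a * ∏ i : Fin m, ξ i.succ ^ n i := by
  simp [Fin.prod_univ_succ]

theorem tsum_weight_eq_tsum_tsum {ξ : Fin (m + 1) → ℂ} (hξ : ∀ i, ‖ξ i‖ ≤ 1)
    {w : (Fin (m + 1) → ℕ) → ℂ} (hw : Summable fun n => ‖w n‖) :
    (Summable fun n : Fin m → ℕ => ‖∑' a : ℕ, ξ 0 ^ a * w (Fin.cons a n)‖) ∧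
    ∑' n, (∏ i, ξ i ^ n i) * w n =
      ∑' n : Fin m → ℕ, (∏ i : Fin m, ξ i.succ ^ n i) * ∑' a : ℕ, ξ 0 ^ a * w (Fin.cons a n) := by
  let E := (Equiv.prodComm (Fin m → ℕ) ℕ).trans (consProdEquiv m)
  have hE (n : Fin m → ℕ) (a : ℕ) : E (n, a) = Fin.cons a n := rfl
  have h1 : Summable fun p => ‖w (E p)‖ := (E.summable_iff (f := fun n => ‖w n‖)).2 hw
  constructor
  · refine Summable.of_nonneg_of_le (fun _ => norm_nonneg _) (fun n => ?_) h1.prod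
    exact tsum_of_norm_bounded (h1.prod_factor n).hasSum fun a => norm_pow_mul_le (hξ 0) a _
  · have h2 := summable_weight_mul hξ hw
    have h3 : Summable fun p => (∏ i, ξ i ^ E p i) * w (E p) :=
      (E.summable_iff (f := fun n => (∏ i, ξ i ^ n i) * w n)).2 h2
    rw [← E.tsum_eq, h3.tsum_prod]
    refine tsum_congr fun n => ?_
    rw [← tsum_mul_left]
    refine tsum_congr fun a => ?_
    simp only [hE, prod_pow_cons]
    ring

theorem tsum_weight_eq_tsum_pow {ξ : Fin (m + 1) → ℂ} (hξ : ∀ i, ‖ξ i‖ ≤ 1)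
    {w : (Fin (m + 1) → ℕ) → ℂ} (hw : Summable fun n => ‖w n‖) :
    (Summable fun a : ℕ =>
      ξ 0 ^ a * ∑' n : Fin m → ℕ, (∏ i : Fin m, ξ i.succ ^ n i) * w (Fin.cons a n)) ∧
    ∑' n, (∏ i, ξ i ^ n i) * w n =
      ∑' a : ℕ, ξ 0 ^ a * ∑' n : Fin m → ℕ, (∏ i : Fin m, ξ i.succ ^ n i) * w (Fin.cons a n) := by
  have h1 : Summable fun p => (∏ i, ξ i ^ consProdEquiv m p i) * w (consProdEquiv m p) :=
    (consProdEquiv m).summable_iff.2 (summable_weight_mul hξ hw)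
  have h2 (a : ℕ) : ∑' n : Fin m → ℕ,
      (∏ i, ξ i ^ consProdEquiv m (a, n) i) * w (consProdEquiv m (a, n)) =
      ξ 0 ^ a * ∑' n : Fin m → ℕ, (∏ i : Fin m, ξ i.succ ^ n i) * w (Fin.cons a n) := by
    rw [← tsum_mul_left]
    refine tsum_congr fun n => ?_
    rw [consProdEquiv_apply, prod_pow_cons, mul_assoc]
  simp only [← h2]
  exact ⟨h1.prod, by rw [← (consProdEquiv m).tsum_eq, h1.tsum_prod]⟩

/-- Splitting off the terms with first coordinate `0` and reindexing the others: this produces the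
boundary term of the summation by parts. -/
theorem tsum_weight_eq_add_tsum_shift {ξ : Fin (m + 1) → ℂ} (hξ : ∀ i, ‖ξ i‖ ≤ 1)
    {w w' : (Fin (m + 1) → ℕ) → ℂ} (hw : Summable fun n => ‖w n‖) (hw' : Summable fun n => ‖w' n‖)
    (h : ∀ a n, w' (Fin.cons a n) = w (Fin.cons (a + 1) n)) :
    ∑' n, (∏ i, ξ i ^ n i) * w n =
      ∑' n : Fin m → ℕ, (∏ i : Fin m, ξ i.succ ^ n i) * w (Fin.cons 0 n) +
        ξ 0 * ∑' n, (∏ i, ξ i ^ n i) * w' n := by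
  obtain ⟨h1, h2⟩ := tsum_weight_eq_tsum_pow hξ hw
  rw [h2, (tsum_weight_eq_tsum_pow hξ hw').2, h1.tsum_eq_zero_add, pow_zero, one_mul,
    ← tsum_mul_left]
  simp only [h, pow_succ', mul_assoc]

/-- The twisted sum `∑_n ξ^n u(s, n)` of a holomorphic family of symbols on `ℕ^m` extends to a
holomorphic function on the whole parameter space, as long as no `ξ_i` is `1`. -/
theorem exists_abelSum {U : Set ℂ} (hU : IsOpen U) {m : ℕ} (ξ : Fin m → ℂ) (hξ : ∀ i, ‖ξ i‖ ≤ 1)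
    (hξ1 : ∀ i, ξ i ≠ 1) {B : ℤ} {u : ℂ → (Fin m → ℕ) → ℂ} (hu : IsSymbol U B u)
    (hd : ∀ n, DifferentiableOn ℂ (fun s => u s n) U) :
    ∃ L : ℂ → ℂ, DifferentiableOn ℂ L U ∧
      (∀ s ∈ U, (Summable fun n => ‖u s n‖) → L s = ∑' n, (∏ i, ξ i ^ n i) * u s n) ∧
      (∀ s ∈ U, ∀ c, (∀ n, u s n = c) → L s = c * ∏ i, (1 - ξ i)⁻¹) := by
  induction m generalizing B with
  | zero =>
    refine ⟨fun s => u s 0, hd 0, fun s hs _ => ?_, fun s hs c hc => by simp [hc]⟩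
    rw [tsum_eq_single 0 fun n hn => (hn (Subsingleton.elim _ _)).elim]
    simp
  | succ m ihm =>
    -- `k` is the number of summations by parts in the first direction that bring the order down to
    -- `-2`, where that coordinate can be summed absolutely.
    obtain ⟨k, hk⟩ : ∃ k : ℕ, B ≤ -2 + k := ⟨(B + 2).toNat, by omega⟩
    induction k generalizing B u with
    | zero =>
      have hB : B ≤ -2 := by simpa using hk
      obtain ⟨L, hL, hLs, hLc⟩ := ihm (fun i => ξ i.succ) (fun i => hξ _) (fun i => hξ1 _)
        (fun k => (hu k).tsum_cons (hξ 0) hB) (fun n => by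
          obtain ⟨C, hC0, hC⟩ := hu.bound
          refine Complex.differentiableOn_tsum_of_summable_norm
            (summable_one_div_succ_sq.mul_left (C * size n ^ (B + 2)))
            (fun a => (hd _).const_mul _) hU fun a s hs => ?_
          refine (norm_pow_mul_le (hξ 0) a _).trans ((hC s hs _).trans ?_)
          rw [mul_assoc, mul_comm (size n ^ _)]
          gcongr
          exact size_cons_zpow_le hB a n)
      refine ⟨L, hL, fun s hs hsum => ?_, fun s hs c hc => ?_⟩
      · obtain ⟨h1, h2⟩ := tsum_weight_eq_tsum_tsum hξ hsum
        rw [hLs s hs h1, h2]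
      · have h0 : c = 0 := by
          have := summable_cons hB (hu 0) hs 0
          simp only [hc, summable_const_iff, norm_eq_zero] at this
          exact this
        subst h0
        rw [hLc s hs 0 (by simp [hc])]
        simp
    | succ k ihk =>
      obtain ⟨L0, hL0, hLs0, hLc0⟩ := ihm (fun i => ξ i.succ) (fun i => hξ _) (fun i => hξ1 _)
        (fun k => (hu k).cons_zero) (fun n => hd _)
      obtain ⟨L1, hL1, hLs1, hLc1⟩ := ihk (hu.fdiff 0) (fun n => (hd _).sub (hd _))
        (by push_cast at hk; omega)
      have hne : 1 - ξ 0 ≠ 0 := sub_ne_zero.2 (hξ1 0).symm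
      -- Summation by parts reads `(1 - ξ_0) ∑ ξ^n u = (boundary sum over n_0 = 0) + ξ_0 ∑ ξ^n Δ_0
      -- u`; where the series diverges, the right-hand side serves as the definition.
      have hL : DifferentiableOn ℂ (fun s => (1 - ξ 0)⁻¹ * (L0 s + ξ 0 * L1 s)) U := by fun_prop
      refine ⟨_, hL, fun s hs hsum => ?_, fun s hs c hc => ?_⟩
      · have hinj : Function.Injective fun n : Fin (m + 1) → ℕ =>
            n + Pi.single (0 : Fin (m + 1)) 1 := add_left_injective _
        have hinj' : Function.Injective fun n : Fin m → ℕ => (Fin.cons 0 n : Fin (m + 1) → ℕ) :=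
          Fin.cons_right_injective (α := fun _ => ℕ) 0
        have hsum1 : Summable fun n => ‖shift 0 u s n‖ := hsum.comp_injective hinj
        have hsum0 := hsum.comp_injective hinj'
        have hsumd : Summable fun n => ‖fdiff 0 u s n‖ :=
          Summable.of_nonneg_of_le (fun _ => norm_nonneg _) (fun n => norm_sub_le _ _)
            (hsum1.add hsum)
        have e : ∑' n, (∏ i, ξ i ^ n i) * fdiff 0 u s n =
            ∑' n, (∏ i, ξ i ^ n i) * shift 0 u s n - ∑' n, (∏ i, ξ i ^ n i) * u s n := by
          rw [← Summable.tsum_sub (summable_weight_mul hξ hsum1) (summable_weight_mul hξ hsum)]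
          simp only [fdiff, shift, mul_sub]
        have e2 := tsum_weight_eq_add_tsum_shift (w' := shift 0 u s) hξ hsum hsum1 fun a n => by
          rw [shift, cons_add_single_zero]
        rw [hLs0 s hs hsum0, hLs1 s hs hsumd, e, inv_mul_eq_iff_eq_mul₀ hne, sub_mul, one_mul]
        nth_rewrite 2 [e2]
        ring
      -- For a constant `u` the difference term has value `0`, and the boundary term acquires the
      -- factor `(1 - ξ_0)⁻¹`.
      · rw [hLc0 s hs c (fun n => hc _), hLc1 s hs 0 (fun n => by simp [fdiff, hc]),
          Fin.prod_univ_succ]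
        ring

end Symbols

end ConeZeta

end

noncomputable section

namespace ConeZeta

/-! ### Products of complex powers of linear forms -/

section Powers

/-- Both comparisons are needed because the exponent may have either sign. -/
theorem zpow_le_of_comparable {x y K : ℝ} (hx : 0 < x) (hy : 0 < y) (h1 : x ≤ K * y)
    (h2 : y ≤ K * x) (B : ℤ) : x ^ B ≤ K ^ B.natAbs * y ^ B := by
  have hK : 0 < K := by
    by_contra h
    nlinarith
  obtain ⟨n, rfl | rfl⟩ := B.eq_nat_or_neg
  · simp only [zpow_natCast, Int.natAbs_natCast, ← mul_pow]
    gcongr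
  · simp only [zpow_neg, zpow_natCast, Int.natAbs_neg, Int.natAbs_natCast]
    rw [← div_eq_mul_inv, le_div_iff₀ (by positivity), inv_mul_le_iff₀ (by positivity), ← mul_pow,
      mul_comm x]
    gcongr

/-- Iterated differences of `t ↦ t^{-s}`, with the given list of steps. -/
def powDiff : List ℝ → ℂ → ℝ → ℂ
  | [], s, t => (t : ℂ) ^ (-s)
  | a :: l, s, t => powDiff l s (t + a) - powDiff l s t

/-- Differentiation commutes with differences, and on `t^{-s}` it replaces `s` by `s + 1` at the
cost of a factor `-s`. -/
theorem hasDerivAt_powDiff (l : List ℝ) (hl : ∀ a ∈ l, 0 ≤ a) (s : ℂ) {t : ℝ} (ht : 0 < t) :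
    HasDerivAt (powDiff l s) (-s * powDiff l (s + 1) t) t := by
  induction l generalizing t with
  | nil =>
    have h : HasDerivAt (fun z : ℂ => z ^ (-s)) (-s * (t : ℂ) ^ (-s - 1)) (t : ℂ) := by
      simpa using (hasDerivAt_id (t : ℂ)).cpow_const (c := -s) (Or.inl (by simpa using ht))
    have := h.comp_ofReal
    rw [show -s - 1 = -(s + 1) by ring] at this
    exact this
  | cons a l ih =>
    have ha : 0 ≤ a := hl a (by simp)
    have hl' : ∀ b ∈ l, 0 ≤ b := fun b hb => hl b (by simp [hb])
    have h1 := (ih hl' (t := t + a) (by linarith)).comp_add_const t a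
    have := h1.sub (ih hl' ht)
    rw [← mul_sub] at this
    exact this

/-- By the mean value inequality, one more difference costs one derivative, which lowers the order
by one. Since the derivative moves `s` to `s + 1`, the induction is over all `A` and `R`. -/
theorem norm_powDiff_le {c : ℝ} (hc : 0 < c) (hc1 : c ≤ 1) (l : List ℝ) (hl : ∀ a ∈ l, 0 ≤ a)
    (A : ℤ) (R : ℝ) : ∃ C, 0 ≤ C ∧ ∀ s : ℂ, ‖s‖ ≤ R → -(A : ℝ) ≤ s.re → ∀ t, c ≤ t →
      ‖powDiff l s t‖ ≤ C * t ^ (A - l.length) := by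
  induction l generalizing A R with
  | nil =>
    -- Write `t^{-Re s} = t^{-(Re s + A)} t^A`. The first exponent is nonpositive, so `t` may be
    -- replaced by `c`; then `c ≤ 1` and `Re s + A ≤ R + |A|` make the bound uniform.
    refine ⟨c ^ (-(R + |(A : ℝ)|)), by positivity, fun s hs hA t ht => ?_⟩
    have ht0 : 0 < t := hc.trans_le ht
    have hre := (abs_le.1 ((Complex.abs_re_le_norm s).trans hs)).2
    have h0 : t ^ (-s.re) = t ^ (-(s.re + A)) * t ^ A := by
      rw [← Real.rpow_intCast, ← Real.rpow_add ht0]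
      ring_nf
    have h1 : t ^ (-(s.re + A)) ≤ c ^ (-(s.re + A)) :=
      Real.rpow_le_rpow_of_nonpos hc ht (by linarith)
    have h2 : c ^ (-(s.re + A)) ≤ c ^ (-(R + |(A : ℝ)|)) :=
      Real.rpow_le_rpow_of_exponent_ge hc hc1 (by linarith [le_abs_self (A : ℝ)])
    rw [powDiff, Complex.norm_cpow_eq_rpow_re_of_pos ht0, Complex.neg_re, h0]
    simp only [List.length_nil, Nat.cast_zero, sub_zero]
    have := zpow_nonneg ht0.le A
    gcongr
    exact h1.trans h2
  | cons a l ih =>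
    have ha : 0 ≤ a := hl a (by simp)
    have hl' : ∀ b ∈ l, 0 ≤ b := fun b hb => hl b (by simp [hb])
    obtain ⟨C, hC0, hC⟩ := ih hl' (A - 1) (R + 1)
    set B : ℤ := A - 1 - l.length with hB
    -- The factors bound, in order, `‖s‖`, the inductive estimate at `s + 1`, the ratio between
    -- points of `[t, t + a]` and `t` (using `t ≥ c`), and the length of the interval.
    refine ⟨|R| * C * (1 + a / c) ^ B.natAbs * a, by positivity, fun s hs hA t ht => ?_⟩
    have ht0 : 0 < t := hc.trans_le ht
    have key : ∀ x ∈ Set.Icc t (t + a), ‖-s * powDiff l (s + 1) x‖ ≤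
        |R| * C * (1 + a / c) ^ B.natAbs * t ^ B := by
      intro x hx
      have hx0 : 0 < x := ht0.trans_le hx.1
      rw [norm_mul, norm_neg]
      have h1 := hC (s + 1) ((norm_add_le _ _).trans (by simpa using hs))
        (by push_cast; simp only [Complex.add_re, Complex.one_re]; linarith) x (ht.trans hx.1)
      have h2 : x ^ B ≤ (1 + a / c) ^ B.natAbs * t ^ B := by
        have hac : a ≤ a / c * t := by
          rw [div_mul_eq_mul_div, le_div_iff₀ hc]
          gcongr
        refine zpow_le_of_comparable hx0 ht0 (by linarith [hx.2]) ?_ B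
        have : 0 ≤ a / c * x := by positivity
        linarith [hx.1]
      calc ‖s‖ * ‖powDiff l (s + 1) x‖ ≤ |R| * (C * x ^ B) :=
            mul_le_mul (hs.trans (le_abs_self R)) h1 (norm_nonneg _) (abs_nonneg _)
        _ ≤ |R| * (C * ((1 + a / c) ^ B.natAbs * t ^ B)) := by gcongr
        _ = _ := by ring
    have hmv := (convex_Icc t (t + a)).norm_image_sub_le_of_norm_hasDerivWithin_le
      (f := powDiff l s) (fun x hx =>
        (hasDerivAt_powDiff l hl' s (ht0.trans_le hx.1)).hasDerivWithinAt) key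
      (Set.left_mem_Icc.2 (by linarith)) (Set.right_mem_Icc.2 (by linarith))
    rw [powDiff]
    refine hmv.trans (le_of_eq ?_)
    rw [add_sub_cancel_left, Real.norm_of_nonneg ha, List.length_cons]
    rw [show A - ((l.length + 1 : ℕ) : ℤ) = B by push_cast; omega]
    ring

variable {m : ℕ}

/-- The affine form `t + ∑_i n_i a_i`. -/
def affineForm (t : ℝ) (a : Fin m → ℝ) (n : Fin m → ℕ) : ℝ := t + ∑ i, n i * a i

theorem affineForm_add_single (t : ℝ) (a : Fin m → ℝ) (n : Fin m → ℕ) (i : Fin m) :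
    affineForm t a (n + Pi.single i 1) = affineForm t a n + a i := by
  simp [affineForm, add_mul, Finset.sum_add_distrib, Pi.single_apply, add_assoc]

theorem le_affineForm (t : ℝ) {a : Fin m → ℝ} (ha : ∀ i, 0 < a i) (n : Fin m → ℕ) :
    t ≤ affineForm t a n :=
  le_add_of_nonneg_right (Finset.sum_nonneg fun i _ => mul_nonneg (Nat.cast_nonneg _) (ha i).le)

theorem affineForm_pos {t : ℝ} (ht : 0 < t) {a : Fin m → ℝ} (ha : ∀ i, 0 < a i) (n : Fin m → ℕ) :
    0 < affineForm t a n := ht.trans_le (le_affineForm t ha n)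

theorem affineForm_comparable {t : ℝ} (ht : 0 < t) {a : Fin m → ℝ} (ha : ∀ i, 0 < a i) :
    ∃ K, 0 < K ∧ ∀ n, affineForm t a n ≤ K * size n ∧ size n ≤ K * affineForm t a n := by
  have hs : 0 ≤ ∑ i, a i := Finset.sum_nonneg fun i _ => (ha i).le
  have hs' : 0 ≤ ∑ i, (a i)⁻¹ := Finset.sum_nonneg fun i _ => (inv_pos.2 (ha i)).le
  set K := t + t⁻¹ + ∑ i, a i + ∑ i, (a i)⁻¹ with hK
  have ht' : 0 < t⁻¹ := inv_pos.2 ht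
  refine ⟨K, by positivity, fun n => ⟨?_, ?_⟩⟩
  · rw [affineForm, size, mul_add, mul_one, Finset.mul_sum]
    refine add_le_add (by linarith) (Finset.sum_le_sum fun i _ => ?_)
    rw [mul_comm]
    have := Finset.single_le_sum (fun j _ => (ha j).le) (Finset.mem_univ i)
    gcongr
    linarith
  · rw [affineForm, size, mul_add, Finset.mul_sum]
    refine add_le_add ?_ (Finset.sum_le_sum fun i _ => ?_)
    · calc 1 = t⁻¹ * t := (inv_mul_cancel₀ ht.ne').symm
        _ ≤ K * t := by gcongr; linarith
    · have := Finset.single_le_sum (f := fun i => (a i)⁻¹) (fun j _ => (inv_pos.2 (ha j)).le)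
        (Finset.mem_univ i)
      calc (n i : ℝ) = (a i)⁻¹ * (n i * a i) := by field_simp [(ha i).ne']
        _ ≤ K * (n i * a i) := by
          have := (ha i).le
          gcongr
          linarith

/-- A unit step in direction `i` adds `a_i` to the form, so every iterated difference is some
`powDiff l` along the form, which is comparable to the size. On the ball of radius `R` one has `-Re
s ≤ R`, whence the order. -/
theorem isSymbol_cpow_affineForm {t : ℝ} (ht : 0 < t) {a : Fin m → ℝ} (ha : ∀ i, 0 < a i) (R : ℕ) :
    IsSymbol (Metric.ball 0 R) R
      (fun s (n : Fin m → ℕ) => (affineForm t a n : ℂ) ^ (-s)) := by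
  obtain ⟨K, hK0, hK⟩ := affineForm_comparable ht ha
  have key (l : List ℝ) (hl : ∀ b ∈ l, 0 ≤ b) : ∃ C, ∀ s ∈ Metric.ball (0 : ℂ) R, ∀ n,
      ‖powDiff l s (affineForm t a n)‖ ≤ C * size n ^ ((R : ℤ) - l.length) := by
    obtain ⟨C, hC0, hC⟩ := norm_powDiff_le (lt_min ht one_pos) (min_le_right _ _) l hl R R
    refine ⟨C * K ^ ((R : ℤ) - l.length).natAbs, fun s hs n => ?_⟩
    rw [mem_ball_zero_iff] at hs
    have hre := (abs_le.1 ((Complex.abs_re_le_norm s).trans hs.le)).1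
    refine (hC s hs.le (by simpa using hre) _ ((min_le_left _ _).trans (le_affineForm t ha n))).trans ?_
    rw [mul_assoc]
    gcongr
    exact zpow_le_of_comparable (affineForm_pos ht ha n) (size_pos n) (hK n).1 (hK n).2 _
  have main (k : ℕ) (l : List ℝ) (hl : ∀ b ∈ l, 0 ≤ b) :
      SymbolBound (Metric.ball 0 R) k ((R : ℤ) - l.length)
        (fun s (n : Fin m → ℕ) => powDiff l s (affineForm t a n)) := by
    induction k generalizing l with
    | zero => exact key l hl
    | succ k ih =>
      refine ⟨key l hl, fun i => ?_⟩
      convert ih (a i :: l) (by simpa using ⟨(ha i).le, hl⟩) using 1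
      · simp only [List.length_cons]
        push_cast
        ring
      · ext s n
        simp only [fdiff, powDiff, affineForm_add_single]
  exact fun k => by simpa [powDiff] using main k [] (by simp)

/-! ### Convergence and continuation of twisted Shintani zeta functions. -/

theorem summable_prod_pi {m : ℕ} {f : ℕ → ℝ} (hf0 : ∀ a, 0 ≤ f a) (hf : Summable f) :
    Summable fun n : Fin m → ℕ => ∏ i, f (n i) := by
  induction m with
  | zero => exact (hasSum_fintype _).summable
  | succ m ih =>
    rw [← (consProdEquiv m).summable_iff]
    have := hf.mul_of_nonneg ih hf0 fun n => Finset.prod_nonneg fun i _ => hf0 _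
    refine this.congr fun p => ?_
    simp [consProdEquiv, Fin.consEquiv, Fin.prod_univ_succ]

/-- Distributing the exponent evenly over the coordinates bounds the term by `∏ (n_i + 1)^{-r/m}`,
and `r/m > 1`. -/
theorem summable_size_rpow {m : ℕ} {r : ℝ} (hm : 0 < m) (hr : m < r) :
    Summable fun n : Fin m → ℕ => size n ^ (-r) := by
  have hm' : (0 : ℝ) < m := Nat.cast_pos.2 hm
  have h1 : Summable fun a : ℕ => ((a : ℝ) + 1) ^ (-(r / m)) := by
    have := (summable_nat_add_iff 1).2 (Real.summable_nat_rpow.2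
      (show -(r / m) < -1 by rw [neg_lt_neg_iff, one_lt_div hm']; exact hr))
    simpa using this
  refine Summable.of_nonneg_of_le (fun n => Real.rpow_nonneg (size_pos n).le _) (fun n => ?_)
    (summable_prod_pi (m := m) (fun a => by positivity) h1)
  have h2 : size n ^ (-r) = ∏ _i : Fin m, size n ^ (-(r / m)) := by
    rw [Finset.prod_const, ← Real.rpow_natCast, ← Real.rpow_mul (size_pos n).le]
    congr 1
    simp
    field_simp
  rw [h2]
  refine Finset.prod_le_prod (fun i _ => Real.rpow_nonneg (size_pos n).le _) fun i _ => ?_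
  refine Real.rpow_le_rpow_of_nonpos (by positivity) ?_ (by
    rw [neg_nonpos]; exact div_nonneg (hm'.le.trans hr.le) hm'.le)
  have := Finset.single_le_sum (f := fun i => (n i : ℝ)) (fun j _ => Nat.cast_nonneg _)
    (Finset.mem_univ i)
  rw [size, add_comm]
  gcongr

variable {S : Type*} [Fintype S]

/-- The term `∏_σ ℓ_σ(n)^{-s}` of a Shintani zeta function. -/
def shintaniTerm (t : S → ℝ) (a : S → Fin m → ℝ) (s : ℂ) (n : Fin m → ℕ) : ℂ :=
  ∏ σ, (affineForm (t σ) (a σ) n : ℂ) ^ (-s)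

/-- Each linear form is comparable to the size, so the term is `O(size^{-d Re s})`, where `d` is the
number of forms and `d Re s > m`. -/
theorem summable_shintaniTerm [Nonempty S] {t : S → ℝ} (ht : ∀ σ, 0 < t σ) {a : S → Fin m → ℝ}
    (ha : ∀ σ i, 0 < a σ i) (hm : 0 < m) {s : ℂ} (hs : (m : ℝ) / Fintype.card S < s.re) :
    Summable fun n => ‖shintaniTerm t a s n‖ := by
  choose K hK0 hK using fun σ => affineForm_comparable (ht σ) (ha σ)
  have hS0 : (0 : ℝ) < Fintype.card S := Nat.cast_pos.2 Fintype.card_pos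
  have hs0 : 0 ≤ s.re := (div_nonneg (Nat.cast_nonneg _) hS0.le).trans hs.le
  have h1 := (summable_size_rpow hm (r := s.re * Fintype.card S) (by
    rwa [div_lt_iff₀ hS0] at hs)).mul_left (∏ σ, (K σ) ^ s.re)
  refine Summable.of_nonneg_of_le (fun _ => norm_nonneg _) (fun n => ?_) h1
  have h2 : size n ^ (-(s.re * Fintype.card S)) = ∏ _σ : S, size n ^ (-s.re) := by
    rw [Finset.prod_const, ← Real.rpow_natCast, ← Real.rpow_mul (size_pos n).le,
      Finset.card_univ, neg_mul]
  rw [shintaniTerm, norm_prod, h2, ← Finset.prod_mul_distrib]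
  refine Finset.prod_le_prod (fun _ _ => norm_nonneg _) fun σ _ => ?_
  have hp := affineForm_pos (ht σ) (ha σ) n
  rw [Complex.norm_cpow_eq_rpow_re_of_pos hp, Complex.neg_re, Real.rpow_neg hp.le,
    Real.rpow_neg (size_pos n).le, ← div_eq_mul_inv, le_div_iff₀ (Real.rpow_pos_of_pos (size_pos n) _),
    inv_mul_le_iff₀ (Real.rpow_pos_of_pos hp _), ← Real.mul_rpow hp.le (hK0 σ).le]
  rw [mul_comm]
  exact Real.rpow_le_rpow (size_pos n).le (hK σ n).2 hs0

theorem differentiable_shintaniTerm {t : S → ℝ} (ht : ∀ σ, 0 < t σ) {a : S → Fin m → ℝ}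
    (ha : ∀ σ i, 0 < a σ i) (n : Fin m → ℕ) : Differentiable ℂ fun s => shintaniTerm t a s n := by
  unfold shintaniTerm
  refine Differentiable.fun_finsetProd fun σ _ => ?_
  exact differentiable_neg.const_cpow
    (Or.inl (Complex.ofReal_ne_zero.2 (affineForm_pos (ht σ) (ha σ) n).ne'))

theorem isSymbol_shintaniTerm {t : S → ℝ} (ht : ∀ σ, 0 < t σ) {a : S → Fin m → ℝ}
    (ha : ∀ σ i, 0 < a σ i) (R : ℕ) :
    IsSymbol (Metric.ball 0 R) (Fintype.card S * R) (shintaniTerm t a) := by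
  have := isSymbol_prod Finset.univ R (fun σ s (n : Fin m → ℕ) =>
    (affineForm (t σ) (a σ) n : ℂ) ^ (-s)) fun σ _ => isSymbol_cpow_affineForm (ht σ) (ha σ) R
  have e : shintaniTerm t a = ∏ σ, fun s (n : Fin m → ℕ) =>
      (affineForm (t σ) (a σ) n : ℂ) ^ (-s) := by
    ext s n
    simp [shintaniTerm]
  rwa [e]

/-- Functions on the balls around `0` which agree near a point glue to an entire function. -/
theorem exists_entire_of_balls {L : ℕ → ℂ → ℂ} {z : ℂ} {R₀ : ℕ} (hz : ‖z‖ < R₀)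
    (hL : ∀ R : ℕ, DifferentiableOn ℂ (L R) (Metric.ball 0 R))
    (hLz : ∀ R R', R₀ ≤ R → R₀ ≤ R' → L R =ᶠ[nhds z] L R') :
    ∃ G : ℂ → ℂ, Differentiable ℂ G ∧
      ∀ R : ℕ, R₀ ≤ R → Set.EqOn G (L R) (Metric.ball 0 R) := by
  have hcomp : ∀ R R' : ℕ, R₀ ≤ R → R ≤ R' → Set.EqOn (L R) (L R') (Metric.ball 0 R) := by
    intro R R' hR hRR'
    have hsub : Metric.ball (0 : ℂ) R ⊆ Metric.ball 0 R' :=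
      Metric.ball_subset_ball (Nat.cast_le.2 hRR')
    refine AnalyticOnNhd.eqOn_of_preconnected_of_eventuallyEq
      ((hL R).analyticOnNhd Metric.isOpen_ball)
      (((hL R').mono hsub).analyticOnNhd Metric.isOpen_ball)
      (convex_ball _ _).isPreconnected (z₀ := z) ?_ (hLz R R' hR (hR.trans hRR'))
    rw [mem_ball_zero_iff]
    exact hz.trans_le (Nat.cast_le.2 hR)
  have hlt (s : ℂ) : ‖s‖ < (⌊‖s‖⌋₊ + 1 + R₀ : ℕ) := by
    push_cast
    linarith [Nat.lt_floor_add_one ‖s‖, (Nat.cast_nonneg R₀ : (0 : ℝ) ≤ R₀)]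
  have hG : ∀ R : ℕ, R₀ ≤ R →
      Set.EqOn (fun s => L (⌊‖s‖⌋₊ + 1 + R₀) s) (L R) (Metric.ball 0 R) := by
    intro R hR s hs
    rcases le_total (⌊‖s‖⌋₊ + 1 + R₀) R with h | h
    · exact hcomp _ _ (by omega) h (mem_ball_zero_iff.2 (hlt s))
    · exact (hcomp _ _ hR h hs).symm
  refine ⟨_, fun s => ?_, hG⟩
  have hs : Metric.ball 0 ((⌊‖s‖⌋₊ + 1 + R₀ : ℕ) : ℝ) ∈ nhds s :=
    Metric.isOpen_ball.mem_nhds (mem_ball_zero_iff.2 (hlt s))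
  exact ((hL _).differentiableAt hs).congr_of_eventuallyEq
    (Filter.eventuallyEq_of_mem hs (hG _ (by omega)))

/-- A Shintani zeta function twisted by nontrivial numbers of absolute value at most `1` in all
directions is entire, and its value at `0` is the value of the geometric series. -/
theorem exists_entire_shintani [Nonempty S] {t : S → ℝ} (ht : ∀ σ, 0 < t σ) {a : S → Fin m → ℝ}
    (ha : ∀ σ i, 0 < a σ i) (hm : 0 < m) {ξ : Fin m → ℂ} (hξ : ∀ i, ‖ξ i‖ ≤ 1)
    (hξ1 : ∀ i, ξ i ≠ 1) :
    ∃ L : ℂ → ℂ, Differentiable ℂ L ∧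
      (∀ s : ℂ, (m : ℝ) / Fintype.card S < s.re →
        HasSum (fun n => (∏ i, ξ i ^ n i) * shintaniTerm t a s n) (L s)) ∧
      L 0 = ∏ i, (1 - ξ i)⁻¹ := by
  -- The order of the symbol grows with the radius, so there is one continuation per ball. They are
  -- glued at `c + 1`, near which the series converges and determines all of them.
  choose L hL hLs hLc using fun R : ℕ => exists_abelSum (Metric.isOpen_ball (x := (0 : ℂ)) (ε := R))
    ξ hξ hξ1 (isSymbol_shintaniTerm ht ha R)
    (fun n => (differentiable_shintaniTerm ht ha n).differentiableOn)
  set c : ℝ := (m : ℝ) / Fintype.card S with hc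
  have hc0 : 0 ≤ c := by positivity
  have hz : ‖((c + 1 : ℝ) : ℂ)‖ < (⌊c⌋₊ + 2 : ℕ) := by
    rw [Complex.norm_real, Real.norm_of_nonneg (by linarith)]
    push_cast
    linarith [Nat.lt_floor_add_one c]
  obtain ⟨G, hG, hGL⟩ := exists_entire_of_balls (L := L) hz hL fun R R' hR hR' => by
    have h1 (R : ℕ) (hR : ⌊c⌋₊ + 2 ≤ R) : Metric.ball 0 (R : ℝ) ∈ nhds ((c + 1 : ℝ) : ℂ) :=
      Metric.isOpen_ball.mem_nhds (mem_ball_zero_iff.2 (hz.trans_le (Nat.cast_le.2 hR)))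
    have h2 : {s : ℂ | c < s.re} ∈ nhds ((c + 1 : ℝ) : ℂ) :=
      (isOpen_lt continuous_const Complex.continuous_re).mem_nhds (by simp)
    filter_upwards [h1 R hR, h1 R' hR', h2] with s hs hs' hcs
    have := summable_shintaniTerm ht ha hm hcs
    rw [hLs R s hs this, hLs R' s hs' this]
  refine ⟨G, hG, fun s hs => ?_, ?_⟩
  · have hmem : s ∈ Metric.ball (0 : ℂ) ((⌊c⌋₊ + 2 + (⌊‖s‖⌋₊ + 1) : ℕ) : ℝ) := by
      rw [mem_ball_zero_iff]
      push_cast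
      linarith [Nat.lt_floor_add_one ‖s‖, (Nat.cast_nonneg ⌊c⌋₊ : (0 : ℝ) ≤ _)]
    have hsum := summable_shintaniTerm ht ha hm hs
    rw [hGL _ (by omega) hmem, hLs _ s hmem hsum]
    exact (summable_weight_mul hξ hsum).hasSum
  · have hmem : (0 : ℂ) ∈ Metric.ball (0 : ℂ) ((⌊c⌋₊ + 2 : ℕ) : ℝ) := by
      rw [mem_ball_zero_iff, norm_zero]
      positivity
    rw [hGL _ le_rfl hmem, hLc _ 0 hmem 1 (fun n => by simp [shintaniTerm]), one_mul]

end Powers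

end ConeZeta

end

noncomputable section

namespace ConeZeta

/-! ### Norms and bounded sets in totally real fields -/

section TotallyReal

variable {F : Type*} [Field F]

theorem abs_le_of_mem_halfOpenCell {m : ℕ} {x : Fin m → F} {y : F}
    (hy : realEmb y ∈ halfOpenCell x Set.univ) (σ : F →+* ℝ) : |σ y| ≤ ∑ i, |σ (x i)| := by
  obtain ⟨c, hc, hc1, h⟩ := hy
  have := congrFun h σ
  simp only [realEmb, Finset.sum_apply, Pi.smul_apply, smul_eq_mul] at this
  rw [this]
  refine (Finset.abs_sum_le_sum_abs _ _).trans (Finset.sum_le_sum fun i _ => ?_)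
  rw [abs_mul, abs_of_pos (hc i)]
  exact mul_le_of_le_one_left (abs_nonneg _) (hc1 i trivial)

variable [IsTotallyReal F]

variable (F) in
/-- The embeddings of a totally real field into `ℂ` are the embeddings into `ℝ`. -/
def realEmbeddingEquiv : (F →+* ℝ) ≃ (F →+* ℂ) :=
  Equiv.ofBijective (fun σ => Complex.ofRealHom.comp σ)
    ⟨fun σ τ h => RingHom.ext fun y => Complex.ofReal_injective (DFunLike.congr_fun h y),
      fun τ => ⟨(IsTotallyReal.complexEmbedding_isReal τ).embedding, RingHom.ext fun y => by simp⟩⟩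

theorem realEmbeddingEquiv_apply (σ : F →+* ℝ) (y : F) : realEmbeddingEquiv F σ y = (σ y : ℂ) := rfl

variable [NumberField F]

theorem card_realEmbedding : Fintype.card (F →+* ℝ) = Module.finrank ℚ F := by
  rw [Fintype.card_congr (realEmbeddingEquiv F), NumberField.Embeddings.card]

instance nonempty_realEmbedding : Nonempty (F →+* ℝ) := (realEmbeddingEquiv F).nonempty

theorem norm_eq_prod_realEmbedding (y : F) :
    ((Algebra.norm ℚ y : ℚ) : ℂ) = ∏ σ : F →+* ℝ, (σ y : ℂ) := by
  have := Algebra.norm_eq_prod_embeddings ℚ ℂ y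
  rw [eq_ratCast] at this
  rw [this]
  refine (Fintype.prod_equiv ((realEmbeddingEquiv F).trans (RingHom.equivRatAlgHom F ℂ)) _ _ ?_).symm
  intro σ
  rfl

/-- The cell is bounded, so `r y` is an algebraic integer with all conjugates bounded. -/
theorem finite_mem_halfOpenCell {m : ℕ} (x : Fin m → F) {r : F} (hr : r ≠ 0) :
    {y : F | realEmb y ∈ halfOpenCell x Set.univ ∧ IsIntegral ℤ (r * y)}.Finite := by
  obtain ⟨B, hB⟩ : ∃ B, ∀ σ : F →+* ℝ, |σ r| * ∑ i, |σ (x i)| ≤ B := by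
    refine ⟨∑ σ : F →+* ℝ, |σ r| * ∑ i, |σ (x i)|, fun σ => ?_⟩
    exact Finset.single_le_sum (f := fun σ : F →+* ℝ => |σ r| * ∑ i, |σ (x i)|)
      (fun _ _ => by positivity) (Finset.mem_univ σ)
  refine ((NumberField.Embeddings.finite_of_norm_le F ℂ B).preimage
    (mul_right_injective₀ hr).injOn).subset fun y hy => ⟨hy.2, fun τ => ?_⟩
  obtain ⟨σ, rfl⟩ := (realEmbeddingEquiv F).surjective τ
  rw [realEmbeddingEquiv_apply, Complex.norm_real, Real.norm_eq_abs, map_mul, abs_mul]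
  refine le_trans ?_ (hB σ)
  gcongr
  exact abs_le_of_mem_halfOpenCell hy.1 σ

/-- The norm is the product of the real conjugates; complex powers are multiplicative here because
these are all positive. -/
theorem norm_cpow_eq_shintaniTerm {m : ℕ} {x : Fin m → F} (hx : ∀ i, TotallyPositive (x i)) {y : F}
    (hy : TotallyPositive y) (s : ℂ) (n : Fin m → ℕ) :
    ((Algebra.norm ℚ (y + ∑ i, n i • x i) : ℚ) : ℂ) ^ (-s) =
      shintaniTerm (fun σ : F →+* ℝ => σ y) (fun σ i => σ (x i)) s n := by
  rw [norm_eq_prod_realEmbedding, shintaniTerm]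
  have h (σ : F →+* ℝ) : σ (y + ∑ i, n i • x i) = affineForm (σ y) (fun i => σ (x i)) n := by
    simp [affineForm, map_sum]
  simp only [h]
  have h0 (σ : F →+* ℝ) : 0 ≤ affineForm (σ y) (fun i => σ (x i)) n :=
    (affineForm_pos (hy σ) (fun i => hx i σ) n).le
  generalize (Finset.univ : Finset (F →+* ℝ)) = S
  classical
  induction S using Finset.induction_on with
  | empty => simp
  | insert a S ha ih =>
    rw [Finset.prod_insert ha, Finset.prod_insert ha, ← ih, ← Complex.ofReal_prod,
      Complex.mul_cpow_ofReal_nonneg (h0 a) (Finset.prod_nonneg fun σ _ => h0 σ)]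

end TotallyReal

/-! ### Decomposition of Shintani cones into translates of a half-open cell -/

section Decomposition

variable {F : Type*} [Field F] {m : ℕ} {x : Fin m → F}

theorem realEmb_add (y z : F) : realEmb (y + z) = realEmb y + realEmb z := by
  ext
  simp [realEmb]

theorem realEmb_nsmul (n : ℕ) (y : F) : realEmb (n • y) = (n : ℝ) • realEmb y := by
  ext
  simp [realEmb]

theorem realEmb_sum_nsmul (x : Fin m → F) (n : Fin m → ℕ) :
    realEmb (∑ i, n i • x i) = ∑ i, (n i : ℝ) • realEmb (x i) := by
  ext
  simp [realEmb, map_sum]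

theorem eq_of_sum_smul_realEmb_eq (hx : LinearIndependent ℝ fun i => realEmb (x i))
    {c d : Fin m → ℝ} (h : ∑ i, c i • realEmb (x i) = ∑ i, d i • realEmb (x i)) : c = d := by
  ext j
  have := Fintype.linearIndependent_iff.1 hx (fun i => c i - d i)
    (by simp [sub_smul, Finset.sum_sub_distrib, h]) j
  linarith

theorem totallyPositive_of_mem_shintaniCone (hx : GeneratesShintaniCone x) {y : F}
    (hy : realEmb y ∈ shintaniCone x) : TotallyPositive y := by
  obtain ⟨c, hc, h⟩ := hy
  intro σ
  have := congrFun h σ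
  simp only [realEmb, Finset.sum_apply, Pi.smul_apply, smul_eq_mul] at this
  rw [this]
  have : Nonempty (Fin m) := ⟨⟨0, hx.pos⟩⟩
  exact Finset.sum_pos (fun i _ => mul_pos (hc i) (hx.totallyPositive i σ)) Finset.univ_nonempty

theorem mem_shintaniCone_of_mem_halfOpenCell {y : F} {J : Set (Fin m)}
    (hy : realEmb y ∈ halfOpenCell x J) : realEmb y ∈ shintaniCone x := by
  obtain ⟨c, hc, -, h⟩ := hy
  exact ⟨c, hc, h⟩

theorem add_mem_shintaniCone {y : F} (hy : realEmb y ∈ shintaniCone x) (n : Fin m → ℕ) :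
    realEmb (y + ∑ i, n i • x i) ∈ shintaniCone x := by
  obtain ⟨c, hc, h⟩ := hy
  refine ⟨fun i => c i + n i, fun i => add_pos_of_pos_of_nonneg (hc i) (Nat.cast_nonneg _), ?_⟩
  rw [realEmb_add, realEmb_sum_nsmul, h, ← Finset.sum_add_distrib]
  simp only [add_smul]

theorem exists_eq_add_of_mem_shintaniCone {y : F} (hy : realEmb y ∈ shintaniCone x) :
    ∃ (z : F) (n : Fin m → ℕ), realEmb z ∈ halfOpenCell x Set.univ ∧ y = z + ∑ i, n i • x i := by
  obtain ⟨c, hc, h⟩ := hy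
  have h1 (i : Fin m) : 1 ≤ ⌈c i⌉₊ := Nat.one_le_ceil_iff.2 (hc i)
  have h2 (i : Fin m) : ((⌈c i⌉₊ - 1 : ℕ) : ℝ) = (⌈c i⌉₊ : ℝ) - 1 := by
    rw [Nat.cast_sub (h1 i), Nat.cast_one]
  -- The cell is `0 < t_i ≤ 1`, so the integral part to remove is `⌈c_i⌉ - 1`, not the floor.
  refine ⟨y - ∑ i, (⌈c i⌉₊ - 1) • x i, fun i => ⌈c i⌉₊ - 1,
    ⟨fun i => c i - (⌈c i⌉₊ - 1 : ℕ), fun i => ?_, fun i _ => ?_, ?_⟩, by abel⟩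
  · dsimp only
    rw [h2]
    linarith [Nat.ceil_lt_add_one (hc i).le]
  · dsimp only
    rw [h2]
    linarith [Nat.le_ceil (c i)]
  · have : realEmb y = realEmb (y - ∑ i, (⌈c i⌉₊ - 1) • x i) +
        ∑ i, ((⌈c i⌉₊ - 1 : ℕ) : ℝ) • realEmb (x i) := by
      rw [← realEmb_sum_nsmul, ← realEmb_add, sub_add_cancel]
    rw [eq_sub_of_add_eq this.symm, h, ← Finset.sum_sub_distrib]
    simp only [sub_smul]

/-- Coordinates are unique by linear independence, and two numbers in `(0, 1]` differ by less than
`1`, which forces equal integral parts. -/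
theorem eq_of_add_eq_add_of_mem_halfOpenCell (hx : LinearIndependent ℝ fun i => realEmb (x i))
    {y z : F} (hy : realEmb y ∈ halfOpenCell x Set.univ) (hz : realEmb z ∈ halfOpenCell x Set.univ)
    {n k : Fin m → ℕ} (h : y + ∑ i, n i • x i = z + ∑ i, k i • x i) : y = z ∧ n = k := by
  obtain ⟨c, hc, hc1, hcy⟩ := hy
  obtain ⟨d, hd, hd1, hdz⟩ := hz
  have e : (fun i => c i + n i) = fun i => d i + k i := by
    apply eq_of_sum_smul_realEmb_eq hx
    simp only [add_smul, Finset.sum_add_distrib]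
    rw [← hcy, ← hdz, ← realEmb_sum_nsmul, ← realEmb_sum_nsmul, ← realEmb_add, ← realEmb_add, h]
  have hnk : n = k := by
    ext i
    have h1 := congrFun e i
    have h2 := hc i
    have h3 := hc1 i trivial
    have h4 := hd i
    have h5 := hd1 i trivial
    have h6 : (n i : ℝ) < k i + 1 := by linarith
    have h7 : (k i : ℝ) < n i + 1 := by linarith
    norm_cast at h6 h7
    omega
  subst hnk
  exact ⟨add_right_cancel h, rfl⟩

/-- The cell spanned by the `q x_i` is tiled by `q^m` translates of the small one; this matches the
finite geometric sums of length `q` in the formal computation. -/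
theorem add_mem_halfOpenCell_nsmul (hx : LinearIndependent ℝ fun i => realEmb (x i)) {q : ℕ}
    (hq : 0 < q) {y : F} (hy : realEmb y ∈ halfOpenCell x Set.univ) (n : Fin m → ℕ) :
    realEmb (y + ∑ i, n i • x i) ∈ halfOpenCell (fun i => q • x i) Set.univ ↔ ∀ i, n i < q := by
  obtain ⟨c, hc, hc1, hcy⟩ := hy
  have hq' : (0 : ℝ) < q := Nat.cast_pos.2 hq
  have e1 : realEmb (y + ∑ i, n i • x i) = ∑ i, (c i + n i) • realEmb (x i) := by
    rw [realEmb_add, realEmb_sum_nsmul, hcy, ← Finset.sum_add_distrib]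
    simp only [add_smul]
  constructor
  · rintro ⟨d, hd, hd1, hdy⟩ i
    have e2 : (fun i => c i + n i) = fun i => d i * q := by
      apply eq_of_sum_smul_realEmb_eq hx
      rw [← e1, hdy]
      simp only [realEmb_nsmul, smul_smul]
    have h1 := congrFun e2 i
    have h2 := hc i
    have h3 : d i * q ≤ 1 * q := by
      gcongr
      exact hd1 i trivial
    have h4 : (n i : ℝ) < q := by linarith
    exact_mod_cast h4
  · intro h
    refine ⟨fun i => (c i + n i) / q, fun i => ?_, fun i _ => ?_, ?_⟩
    · have := hc i
      positivity
    · rw [div_le_one hq']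
      have h1 : (n i : ℝ) + 1 ≤ q := by exact_mod_cast h i
      linarith [hc1 i trivial]
    · rw [e1]
      refine Finset.sum_congr rfl fun i _ => ?_
      rw [realEmb_nsmul, smul_smul, div_mul_cancel₀ _ hq'.ne']

theorem shintaniCone_nsmul (x : Fin m → F) {q : ℕ} (hq : 0 < q) :
    shintaniCone (fun i => q • x i) = shintaniCone x := by
  have hq' : (0 : ℝ) < q := Nat.cast_pos.2 hq
  ext z
  constructor
  · rintro ⟨c, hc, rfl⟩
    exact ⟨fun i => c i * q, fun i => mul_pos (hc i) hq', by simp only [realEmb_nsmul, smul_smul]⟩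
  · rintro ⟨c, hc, rfl⟩
    exact ⟨fun i => c i / q, fun i => div_pos (hc i) hq', by
      simp only [realEmb_nsmul, smul_smul, div_mul_cancel₀ _ hq'.ne']⟩

theorem linearIndependent_realEmb_nsmul (hx : LinearIndependent ℝ fun i => realEmb (x i)) {q : ℕ}
    (hq : 0 < q) : LinearIndependent ℝ fun i => realEmb (q • x i) := by
  simp only [realEmb_nsmul]
  exact hx.units_smul fun _ => Units.mk0 (q : ℝ) (Nat.cast_pos.2 hq).ne'

theorem GeneratesShintaniCone.nsmul (hx : GeneratesShintaniCone x) {q : ℕ} (hq : 0 < q) :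
    GeneratesShintaniCone fun i => q • x i where
  pos := hx.pos
  totallyPositive i σ := by
    rw [map_nsmul]
    exact nsmul_pos (hx.totallyPositive i σ) hq.ne'
  linearIndependent := linearIndependent_realEmb_nsmul hx.linearIndependent hq

theorem apply_add_sum_nsmul {R : Type*} [CommRing R] {g : F → R} {c : Fin m → R}
    (hg : ∀ i y, g (y + x i) = c i * g y) (y : F) (n : Fin m → ℕ) :
    g (y + ∑ i, n i • x i) = (∏ i, c i ^ n i) * g y := by
  have h1 (i : Fin m) (k : ℕ) (y : F) : g (y + k • x i) = c i ^ k * g y := by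
    induction k with
    | zero => simp
    | succ k ih => rw [succ_nsmul, ← add_assoc, hg, ih, pow_succ', mul_assoc]
  classical
  generalize (Finset.univ : Finset (Fin m)) = S
  induction S using Finset.induction_on with
  | empty => simp
  | insert a S ha ih =>
    rw [Finset.sum_insert ha, Finset.prod_insert ha, add_comm (n a • x a), ← add_assoc, h1, ih,
      mul_assoc]

end Decomposition

end ConeZeta

end

noncomputable section

namespace ConeZeta

/-! ### Formal and analytic sums of quasi-periodic functions over Shintani cones -/

section QuasiPeriodic

theorem foldr_diffOp_sum {F ι : Type*} [Field F] (ys : List F) (S : Finset ι) (g : ι → F → Qbar) :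
    ys.foldr diffOp (∑ k ∈ S, g k) = ∑ k ∈ S, ys.foldr diffOp (g k) := by
  induction ys with
  | nil => rfl
  | cons a l ih =>
    simp only [List.foldr_cons, ih]
    ext y
    simp [diffOp, Finset.sum_apply, Finset.sum_sub_distrib]

variable {F : Type*} [Field F] [NumberField F] {κ : Type*}
  (b : Module.Basis κ Qbar (Qbar ⊗[ℚ] F))

theorem constantCoeff_expSeries (y : F) : MvPowerSeries.constantCoeff (expSeries b y) = 1 := by
  have h := expSeries_sub_mem b y 1
  have h1 := MvPowerSeries.coeff_of_lt_order (d := 0)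
    (lt_of_lt_of_le (b := ((1 : ℕ) : ℕ∞)) (by simp) (show ((1 : ℕ) : ℕ∞) ≤ _ from h))
  simpa [sub_eq_zero] using h1

theorem expSeries_zero : expSeries b (0 : F) = 1 := by
  have h := expSeries_add b (0 : F) 0
  have hne : expSeries b (0 : F) ≠ 0 := fun h0 => by
    simpa [h0] using constantCoeff_expSeries b (0 : F)
  rw [add_zero] at h
  exact mul_left_cancel₀ hne (by rw [← h, mul_one])

theorem expSeries_nsmul (n : ℕ) (y : F) : expSeries b (n • y) = expSeries b y ^ n := by
  induction n with
  | zero => rw [zero_nsmul, expSeries_zero, pow_zero]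
  | succ n ih => rw [succ_nsmul, expSeries_add, ih, pow_succ]

theorem expSeries_sum_nsmul {m : ℕ} (x : Fin m → F) (n : Fin m → ℕ) :
    expSeries b (∑ i, n i • x i) = ∏ i, expSeries b (x i) ^ n i := by
  classical
  generalize (Finset.univ : Finset (Fin m)) = S
  induction S using Finset.induction_on with
  | empty => simp [expSeries_zero]
  | insert a S ha ih =>
    rw [Finset.sum_insert ha, Finset.prod_insert ha, expSeries_add, ih, expSeries_nsmul]

variable {m : ℕ} {x : Fin m → F} {g : F → Qbar} {c : Fin m → Qbar} {q : ℕ}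

/-- The regularised value of the sum of `g(y) exp(y)` over a cone, for a quasi-periodic function
`g` with multipliers `c_i ≠ 1`, whose nonzero values on the half-open cell are attained on `D`. -/
def twistedSeries (x : Fin m → F) (g : F → Qbar) (c : Fin m → Qbar) (D : Finset F) :
    SeriesRing κ :=
  (∑ y ∈ D, MvPowerSeries.C (g y) * expSeries b y) *
    ∏ i, (1 - MvPowerSeries.C (c i) * expSeries b (x i))⁻¹

theorem constantCoeff_one_sub (a : Qbar) (y : F) :
    MvPowerSeries.constantCoeff (1 - MvPowerSeries.C a * expSeries b y) = 1 - a := by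
  simp [constantCoeff_expSeries]

/-- No condition on the `c_i` is needed: if `c_i = 1`, both the power series inverse and the inverse
of its constant term are `0` by convention. -/
theorem constantCoeff_twistedSeries (D : Finset F) :
    MvPowerSeries.constantCoeff (twistedSeries b x g c D) =
      (∑ y ∈ D, g y) * ∏ i, (1 - c i)⁻¹ := by
  simp only [twistedSeries, map_mul, map_sum, map_prod, MvPowerSeries.constantCoeff_inv,
    constantCoeff_one_sub, constantCoeff_expSeries, MvPowerSeries.constantCoeff_C, mul_one]

open Classical in
/-- The regularised sum of `g(y) exp(y)` over a cone, for a quasi-periodic function `g`. -/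
theorem exists_foldr_diffOp_eq (hx : LinearIndependent ℝ fun i => realEmb (x i))
    (hg : ∀ i y, g (y + x i) = c i * g y) (hq : 0 < q) (hcq : ∀ i, c i ^ q = 1)
    (hc1 : ∀ i, c i ≠ 1) (D : Finset F)
    (hD : ∀ y, y ∈ D ↔ realEmb y ∈ halfOpenCell x Set.univ ∧ g y ≠ 0) :
    ∃ h : F →₀ Qbar,
      ((List.finRange m).map fun i => q • x i).foldr diffOp
        (fun y => if realEmb y ∈ shintaniCone x then g y else 0) = ⇑h ∧
      (((List.finRange m).map fun i => q • x i).map fun y => 1 - expSeries b y).prod *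
        twistedSeries b x g c D = expSum b h := by
  -- Since `c_i^q = 1`, the function is honestly periodic under `q x_i`; these steps regularise the
  -- sum.
  have hper : ∀ i y, g (y - q • x i) = g y := fun i y => by
    have := apply_add_sum_nsmul hg (y - q • x i) (Pi.single i q)
    have e : ∑ j, (Pi.single i q : Fin m → ℕ) j • x j = q • x i := by
      rw [Finset.sum_eq_single i (fun j _ hj => by simp [hj]) (by simp)]
      simp
    have e' : ∏ j, c j ^ (Pi.single i q : Fin m → ℕ) j = 1 := by
      refine Finset.prod_eq_one fun j _ => ?_
      by_cases hj : j = i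
      · subst hj
        simp [hcq]
      · simp [hj]
    rw [e, e', sub_add_cancel, one_mul] at this
    exact this.symm
  have hfold := foldr_diffOp_indicator (x := fun i => q • x i)
    (linearIndependent_realEmb_nsmul hx hq) g hper (List.finRange m) (List.nodup_finRange m)
  rw [shintaniCone_nsmul x hq] at hfold
  simp only [List.mem_finRange, Set.ofPred_true] at hfold
  set N : Finset (Fin m → ℕ) := Fintype.piFinset fun _ => Finset.range q with hN
  have hmemN (n : Fin m → ℕ) : n ∈ N ↔ ∀ i, n i < q := by simp [hN]
  set f : F × (Fin m → ℕ) → F := fun p => p.1 + ∑ i, p.2 i • x i with hf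
  have hinj : Set.InjOn f ↑(D ×ˢ N) := by
    rintro ⟨y, n⟩ hy ⟨z, k⟩ hz h
    simp only [Finset.coe_product, Set.mem_prod, Finset.mem_coe] at hy hz
    obtain ⟨h1, h2⟩ := eq_of_add_eq_add_of_mem_halfOpenCell hx ((hD y).1 hy.1).1 ((hD z).1 hz.1).1 h
    exact Prod.ext h1 h2
  have hsupp : ∀ y, (if realEmb y ∈ halfOpenCell (fun i => q • x i) Set.univ then g y else 0) ≠ 0 →
      y ∈ (D ×ˢ N).image f := by
    intro y hy
    rw [ne_eq, ite_eq_right_iff, not_forall] at hy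
    obtain ⟨hy1, hy2⟩ := hy
    have hy3 : realEmb y ∈ shintaniCone x := by
      rw [← shintaniCone_nsmul x hq]
      exact mem_shintaniCone_of_mem_halfOpenCell hy1
    obtain ⟨z, n, hz, rfl⟩ := exists_eq_add_of_mem_shintaniCone hy3
    rw [apply_add_sum_nsmul hg] at hy2
    refine Finset.mem_image.2 ⟨(z, n), Finset.mem_product.2 ⟨(hD z).2
      ⟨hz, right_ne_zero_of_mul hy2⟩, ?_⟩, rfl⟩
    exact (hmemN n).2 ((add_mem_halfOpenCell_nsmul hx hq hz n).1 hy1)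
  refine ⟨Finsupp.onFinset _ _ hsupp, by rw [Finsupp.coe_onFinset, hfold], ?_⟩
  rw [expSum_apply, Finsupp.onFinset_sum _ (by simp), Finset.sum_image hinj, Finset.sum_product]
  have hprod : (((List.finRange m).map fun i => q • x i).map fun y => 1 - expSeries b y).prod =
      ∏ i, (1 - expSeries b (x i) ^ q) := by
    rw [List.map_map, ← List.ofFn_eq_map, List.prod_ofFn]
    simp only [Function.comp_apply, expSeries_nsmul]
  -- As `c_i^q = 1`, the left side is also `1 - (c_i exp(x_i))^q`. The factor `1 - c_i exp(x_i)`
  -- cancels against the denominator of `twistedSeries`, leaving a finite sum over the tiles.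
  have hgeom (i : Fin m) : 1 - expSeries b (x i) ^ q =
      (1 - MvPowerSeries.C (c i) * expSeries b (x i)) *
        ∑ k ∈ Finset.range q, (MvPowerSeries.C (c i) * expSeries b (x i)) ^ k := by
    rw [mul_neg_geom_sum, mul_pow, ← map_pow, hcq, map_one, one_mul]
  have hinv (i : Fin m) : (1 - MvPowerSeries.C (c i) * expSeries b (x i)) *
      (1 - MvPowerSeries.C (c i) * expSeries b (x i))⁻¹ = 1 :=
    MvPowerSeries.mul_inv_cancel _ (by
      rw [constantCoeff_one_sub]
      exact sub_ne_zero.2 (hc1 i).symm)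
  have hcancel : (∏ i, (1 - expSeries b (x i) ^ q)) *
      ∏ i, (1 - MvPowerSeries.C (c i) * expSeries b (x i))⁻¹ =
      ∏ i, ∑ k ∈ Finset.range q, (MvPowerSeries.C (c i) * expSeries b (x i)) ^ k := by
    rw [← Finset.prod_mul_distrib]
    refine Finset.prod_congr rfl fun i _ => ?_
    rw [hgeom, mul_right_comm, hinv, one_mul]
  rw [hprod, twistedSeries, mul_left_comm, hcancel, Finset.prod_univ_sum, Finset.sum_mul]
  refine Finset.sum_congr rfl fun y hy => ?_
  rw [Finset.mul_sum]
  refine Finset.sum_congr rfl fun n hn => ?_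
  rw [if_pos ((add_mem_halfOpenCell_nsmul hx hq ((hD y).1 hy).1 n).2 ((hmemN n).1 hn)),
    apply_add_sum_nsmul hg, expSeries_add, expSeries_sum_nsmul, map_mul, map_prod]
  simp only [mul_pow, Finset.prod_mul_distrib, map_pow]
  ring

open Classical in
/-- The Dirichlet series `∑_{y ∈ C} g(y) N(y)^{-s}` over a Shintani cone `C`, for a quasi-periodic
function `g` with nontrivial multipliers, is entire, and its value at `0` is the constant term of
the regularised exponential sum. -/
theorem exists_entire_twisted [IsTotallyReal F] (hx : GeneratesShintaniCone x)
    (hg : ∀ i y, g (y + x i) = c i * g y) (hq : 0 < q) (hcq : ∀ i, c i ^ q = 1)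
    (hc1 : ∀ i, c i ≠ 1) (D : Finset F)
    (hD : ∀ y, y ∈ D ↔ realEmb y ∈ halfOpenCell x Set.univ ∧ g y ≠ 0) (j : Qbar →+* ℂ) :
    ∃ L : ℂ → ℂ, Differentiable ℂ L ∧
      (∀ s : ℂ, (m : ℝ) / Module.finrank ℚ F < s.re →
        HasSum (fun y => j (g y) * (if realEmb y ∈ shintaniCone x then 1 else 0) *
          ((Algebra.norm ℚ y : ℚ) : ℂ) ^ (-s)) (L s)) ∧
      L 0 = j ((∑ y ∈ D, g y) * ∏ i, (1 - c i)⁻¹) := by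
  have hpos (y : F) (hy : y ∈ D) : TotallyPositive y :=
    totallyPositive_of_mem_shintaniCone hx (mem_shintaniCone_of_mem_halfOpenCell ((hD y).1 hy).1)
  have hξ (i : Fin m) : ‖j (c i)‖ ≤ 1 :=
    (pow_le_one_iff_of_nonneg (norm_nonneg _) hq.ne').1 (by
      rw [← norm_pow, ← map_pow, hcq, map_one, norm_one])
  have hξ1 (i : Fin m) : j (c i) ≠ 1 := fun h => hc1 i (j.injective (by rw [h, map_one]))
  have key (y : F) (hy : y ∈ D) := exists_entire_shintani
    (t := fun σ : F →+* ℝ => σ y) (a := fun σ i => σ (x i)) (hpos y hy)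
    (fun σ i => hx.totallyPositive i σ) hx.pos hξ hξ1
  choose! L hL hLs hL0 using key
  refine ⟨fun s => ∑ y ∈ D, j (g y) * L y s, ?_, fun s hs => ?_, ?_⟩
  · exact Differentiable.fun_sum fun y hy => (hL y hy).const_mul _
  · set T : F → ℂ := fun y => j (g y) * (if realEmb y ∈ shintaniCone x then 1 else 0) *
      ((Algebra.norm ℚ y : ℚ) : ℂ) ^ (-s) with hT
    set f : F → (Fin m → ℕ) → F := fun y n => y + ∑ i, n i • x i with hf
    -- The orbits `z + ∑ ℕ x_i` of the points of `D` are disjoint and cover all points where the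
    -- term is nonzero.
    have hTsum : T = fun y => ∑ z ∈ D, (Set.range (f z)).indicator T y := by
      ext y
      by_cases hy : T y = 0
      · rw [hy, Finset.sum_eq_zero]
        intro z _
        by_cases hyz : y ∈ Set.range (f z)
        · rw [Set.indicator_of_mem hyz, hy]
        · rw [Set.indicator_of_notMem hyz]
      · have hyC : realEmb y ∈ shintaniCone x := by
          by_contra h
          simp [hT, h] at hy
        have hgy : g y ≠ 0 := by
          intro h
          simp [hT, h] at hy
        obtain ⟨z, n, hz, rfl⟩ := exists_eq_add_of_mem_shintaniCone hyC
        have hzD : z ∈ D := (hD z).2 ⟨hz, fun h0 => hgy (by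
          rw [apply_add_sum_nsmul hg, h0, mul_zero])⟩
        rw [Finset.sum_eq_single z, Set.indicator_of_mem (Set.mem_range.2 ⟨n, rfl⟩)]
        · intro w hw hwz
          refine Set.indicator_of_notMem ?_ _
          rintro ⟨k, hk⟩
          exact hwz (eq_of_add_eq_add_of_mem_halfOpenCell hx.linearIndependent
            ((hD w).1 hw).1 hz hk).1
        · exact fun h => (h hzD).elim
    rw [hTsum]
    refine hasSum_sum fun y hy => ?_
    have hinj : Function.Injective (f y) := fun n k h =>
      (eq_of_add_eq_add_of_mem_halfOpenCell hx.linearIndependent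
        ((hD y).1 hy).1 ((hD y).1 hy).1 h).2
    rw [← hasSum_subtype_iff_indicator]
    refine (hinj.hasSum_range_iff (f := T)).2 ?_
    have := (hLs y hy s (by rwa [card_realEmbedding])).mul_left (j (g y))
    have e : T ∘ f y = fun n => j (g y) * ((∏ i, j (c i) ^ n i) *
        shintaniTerm (fun σ : F →+* ℝ => σ y) (fun σ i => σ (x i)) s n) := ?_
    · rwa [e]
    ext n
    rw [Function.comp_apply, hT]
    dsimp only
    rw [if_pos (add_mem_shintaniCone (mem_shintaniCone_of_mem_halfOpenCell ((hD y).1 hy).1) n),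
      norm_cpow_eq_shintaniTerm hx.totallyPositive (hpos y hy), apply_add_sum_nsmul hg, map_mul,
      map_prod]
    simp only [map_pow]
    ring
  · rw [map_mul, map_sum, Finset.sum_mul]
    refine Finset.sum_congr rfl fun y hy => ?_
    rw [hL0 y hy, map_prod]
    simp [map_inv₀]

end QuasiPeriodic

end ConeZeta

end

noncomputable section

namespace ConeZeta

/-! ### Schwartz functions on the adeles away from `q` -/

section Schwartz

/-- Compactness of the support makes local constancy uniform there. If only `a + w` lies in the
support, the same statement is used at that point with `-w`. -/
theorem eventually_forall_add_eq {A R : Type*} [TopologicalSpace A] [AddCommGroup A]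
    [IsTopologicalAddGroup A] [CommRing R] {φ : A → R} (hφ : φ ∈ schwartz A R) :
    ∀ᶠ w in nhds (0 : A), ∀ a, φ (a + w) = φ a := by
  obtain ⟨hloc, hcomp⟩ := hφ
  have h1 : ∀ᶠ w in nhds (0 : A), ∀ a ∈ tsupport φ, φ (a + w) = φ a := by
    refine IsCompact.eventually_forall_of_forall_eventually hcomp fun a _ => ?_
    have e1 : Filter.Tendsto (fun z : A × A => z.2 + z.1) (nhds (0, a)) (nhds a) := by
      have : Continuous fun z : A × A => z.2 + z.1 := by fun_prop
      simpa using this.tendsto (0, a)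
    have e2 : Filter.Tendsto (fun z : A × A => z.2) (nhds (0, a)) (nhds a) :=
      continuous_snd.tendsto (0, a)
    filter_upwards [e1.eventually (hloc.eventually_eq a), e2.eventually (hloc.eventually_eq a)]
      with z hz1 hz2
    rw [hz1, hz2]
  have h2 : Filter.Tendsto (fun w : A => -w) (nhds 0) (nhds 0) := by
    simpa using (continuous_neg (G := A)).tendsto 0
  filter_upwards [h1, h2.eventually h1] with w hw hw' a
  by_cases ha : a ∈ tsupport φ
  · exact hw a ha
  · by_cases haw : a + w ∈ tsupport φ
    · simpa using (hw' _ haw).symm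
    · rw [image_eq_zero_of_notMem_tsupport ha, image_eq_zero_of_notMem_tsupport haw]

theorem finite_range_of_mem_schwartz {A R : Type*} [TopologicalSpace A] [CommRing R] {φ : A → R}
    (hφ : φ ∈ schwartz A R) : (Set.range φ).Finite := by
  obtain ⟨hloc, hcomp⟩ := hφ
  have h : (φ '' tsupport φ).Finite := by
    refine IsCompact.induction_on hcomp (p := fun S => (φ '' S).Finite) (by simp)
      (fun s t hst ht => ht.subset (Set.image_mono hst))
      (fun s t hs ht => by rw [Set.image_union]; exact hs.union ht) fun a _ => ?_
    refine ⟨{b | φ b = φ a}, mem_nhdsWithin_of_mem_nhds (hloc.eventually_eq a), ?_⟩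
    exact (Set.finite_singleton (φ a)).subset (by rintro _ ⟨b, hb, rfl⟩; exact hb)
  refine (h.union (Set.finite_singleton 0)).subset ?_
  rintro _ ⟨a, rfl⟩
  by_cases ha : a ∈ tsupport φ
  · exact Or.inl ⟨a, ha, rfl⟩
  · exact Or.inr (image_eq_zero_of_notMem_tsupport ha)

/-- Finiteness of the range is essential: a supremum of an unbounded set of reals is `0` by
convention. -/
theorem norm_le_maxNorm {A R K : Type*} [TopologicalSpace A] [CommRing R] [NormedRing K]
    (j : R →+* K) {φ : A → R} (hφ : φ ∈ schwartz A R) (a : A) : ‖j (φ a)‖ ≤ maxNorm j φ := by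
  refine le_ciSup (f := fun a => ‖j (φ a)‖) ?_ a
  refine (((finite_range_of_mem_schwartz hφ).image fun z => ‖j z‖).subset ?_).bddAbove
  rintro _ ⟨b, rfl⟩
  exact ⟨_, ⟨b, rfl⟩, rfl⟩

end Schwartz

/-! ### Translation invariance and denominators away from `q`. -/

section Away

variable {F : Type*} [Field F] [NumberField F] {q : ℕ}

theorem valued_algebraMap (v : FinPlace F) (y : F) :
    Valued.v (algebraMap F (v.adicCompletion F) y) = v.valuation F y :=
  v.valuedAdicCompletion_eq_valuation' y

/-- The diagonal embedding of `F` into the adeles away from `q`. -/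
def diagAway (q : ℕ) (y : F) : AdelesAway F q := awayPart q (algebraMap F _ y)

theorem diagAway_apply (y : F) (v : {v : FinPlace F // ¬ Above q v}) :
    diagAway q y v = algebraMap F (v.1.adicCompletion F) y := rfl

theorem diagAway_add (y z : F) : diagAway q (y + z) = diagAway q y + diagAway q z :=
  RestrictedProduct.ext _ _ fun v => map_add (algebraMap F (v.1.adicCompletion F)) y z

instance isOpen_integers_away : Fact (∀ v : {v : FinPlace F // ¬ Above q v},
    IsOpen (v.1.adicCompletionIntegers F : Set (v.1.adicCompletion F))) :=
  ⟨fun _ => Valued.isOpen_valuationSubring _⟩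

theorem valuation_natCast_le_one (v : FinPlace F) (n : ℕ) : v.valuation F (n : F) ≤ 1 := by
  have := v.valuation_le_one (K := F) (n : 𝓞 F)
  simpa using this

theorem valuation_natCast_lt_one_iff (v : FinPlace F) (n : ℕ) :
    v.valuation F (n : F) < 1 ↔ (n : 𝓞 F) ∈ v.asIdeal := by
  rw [← v.valuation_lt_one_iff_mem (K := F)]
  simp

/-- A natural number prime to `q` is a unit at the places above `q`. -/
theorem valuation_natCast_eq_one {v : FinPlace F} (hv : Above q v) {n : ℕ} (hn : n.Coprime q) :
    v.valuation F (n : F) = 1 := by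
  refine le_antisymm (valuation_natCast_le_one v n) (not_lt.1 fun h => ?_)
  rw [valuation_natCast_lt_one_iff] at h
  refine v.isPrime.ne_top ((Ideal.eq_top_iff_one _).2 ?_)
  have h1 := (Nat.isCoprime_iff_coprime.2 hn).map (Int.castRingHom (𝓞 F))
  obtain ⟨a, c, hac⟩ := h1
  rw [← hac]
  exact Ideal.add_mem _ (Ideal.mul_mem_left _ _ (by simpa using h))
    (Ideal.mul_mem_left _ _ (by simpa using show (q : 𝓞 F) ∈ v.asIdeal from hv))

/-- The norm of the prime lies in it, while `q` does not; hence the prime-to-`q` part of the norm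
lies in it, and a high power of that is small. -/
theorem exists_coprime_valuation_lt (hq : q.Prime) {v : FinPlace F} (hv : ¬ Above q v)
    {γ : WithZero (Multiplicative ℤ)} (hγ : γ ≠ 0) :
    ∃ M : ℕ, 0 < M ∧ M.Coprime q ∧ v.valuation F (M : F) < γ := by
  have hN : Ideal.absNorm v.asIdeal ≠ 0 := by
    rw [ne_eq, Ideal.absNorm_eq_zero_iff]
    exact v.ne_bot
  obtain ⟨e, N, hqN, hN'⟩ := Nat.exists_eq_pow_mul_and_not_dvd hN q hq.ne_one
  have hmem : ((q : 𝓞 F)) ^ e * (N : 𝓞 F) ∈ v.asIdeal := by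
    have := Ideal.absNorm_mem v.asIdeal
    rw [hN'] at this
    exact_mod_cast this
  have hN1 : (N : 𝓞 F) ∈ v.asIdeal := by
    rcases v.isPrime.mem_or_mem hmem with h | h
    · exact (hv (v.isPrime.mem_of_pow_mem _ h)).elim
    · exact h
  obtain ⟨k, hk⟩ := exists_pow_lt₀ ((valuation_natCast_lt_one_iff v N).2 hN1) (Units.mk0 γ hγ)
  refine ⟨N ^ k, pow_pos (Nat.pos_of_ne_zero fun h => hqN (by rw [h]; exact dvd_zero q)) k,
    ((hq.coprime_iff_not_dvd.2 hqN).symm).pow_left k, ?_⟩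
  simpa using hk

theorem exists_valued_lt_subset {v : FinPlace F} {t : Set (v.adicCompletion F)} (ht : t ∈ nhds 0) :
    ∃ γ : WithZero (Multiplicative ℤ), γ ≠ 0 ∧ ∀ z, Valued.v z < γ → z ∈ t := by
  obtain ⟨γ, hγ⟩ := Valued.mem_nhds_zero.1 ht
  refine ⟨MonoidWithZeroHom.ValueGroup₀.embedding γ.1, ?_, fun z hz => hγ ?_⟩
  · exact (map_ne_zero _).2 γ.ne_zero
  · exact (Valuation.restrict_lt_iff_lt_embedding _).2 hz

/-- Within `∏ 𝓞_v`, a neighbourhood of `0` contains one constraining only finitely many places.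
Natural numbers are integral everywhere, so a product of one suitable number per constrained place
works. -/
theorem exists_coprime_diagAway_mem (hq : q.Prime) {W : Set (AdelesAway F q)} (hW : W ∈ nhds 0) :
    ∃ M : ℕ, 0 < M ∧ M.Coprime q ∧ diagAway q (M : F) ∈ W := by
  classical
  have hcont : Continuous (RestrictedProduct.structureMap
      (fun v : {v : FinPlace F // ¬ Above q v} => v.1.adicCompletion F)
      (fun v => (v.1.adicCompletionIntegers F : Set (v.1.adicCompletion F))) Filter.cofinite) :=
    RestrictedProduct.isEmbedding_structureMap.continuous
  have h1 := hcont.tendsto 0 hW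
  rw [Filter.mem_map, nhds_pi, Filter.mem_pi] at h1
  obtain ⟨I, hI, t, ht, hsub⟩ := h1
  have h2 (v : {v : FinPlace F // ¬ Above q v}) : ∃ M : ℕ, 0 < M ∧ M.Coprime q ∧
      -- The bound by the valuation of `M` lets every multiple of `M` qualify, in particular the
      -- product over all places of `I`.
      ∀ z : v.1.adicCompletionIntegers F, Valued.v z.1 ≤ v.1.valuation F (M : F) → z ∈ t v := by
    obtain ⟨u, hu, hut⟩ := mem_nhds_subtype _ _ _ |>.1 (ht v)
    obtain ⟨γ, hγ0, hγ⟩ := exists_valued_lt_subset hu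
    obtain ⟨M, hM0, hM, hMγ⟩ := exists_coprime_valuation_lt hq v.2 hγ0
    exact ⟨M, hM0, hM, fun z hz => hut (hγ _ (hz.trans_lt hMγ))⟩
  choose M hM0 hM hMt using h2
  set N : ℕ := ∏ v ∈ hI.toFinset, M v with hN
  refine ⟨N, Finset.prod_pos fun v _ => hM0 v, Nat.Coprime.prod_left fun v _ => hM v, ?_⟩
  have hNv (v : FinPlace F) : Valued.v (algebraMap F (v.adicCompletion F) (N : F)) = v.valuation F (N : F) :=
    valued_algebraMap v _
  have hmem : (fun v : {v : FinPlace F // ¬ Above q v} =>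
      (⟨algebraMap F (v.1.adicCompletion F) (N : F), by
        rw [HeightOneSpectrum.mem_adicCompletionIntegers, hNv]
        exact valuation_natCast_le_one _ _⟩ : v.1.adicCompletionIntegers F)) ∈ I.pi t := by
    intro v hv
    refine hMt v _ ?_
    dsimp only
    rw [hNv, hN, ← Finset.mul_prod_erase _ _ (hI.mem_toFinset.2 hv), Nat.cast_mul, map_mul]
    exact mul_le_of_le_one_right' (valuation_natCast_le_one _ _)
  exact hsub hmem

/-- A Schwartz function away from `q` is invariant under translation by suitable multiples, prime
to `q`, of given elements of `F`. -/
theorem exists_coprime_forall_add_eq (hq : q.Prime) {R : Type*} [CommRing R]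
    {φ : AdelesAway F q → R} (hφ : φ ∈ schwartz (AdelesAway F q) R) {m : ℕ} (x : Fin m → F) :
    ∃ M : ℕ, 0 < M ∧ M.Coprime q ∧
      ∀ i y, φ (diagAway q (y + M • x i)) = φ (diagAway q y) := by
  have h := eventually_forall_add_eq hφ
  have h1 : ∀ᶠ w in nhds (0 : AdelesAway F q), ∀ i, ∀ a, φ (a + w * diagAway q (x i)) = φ a := by
    refine Filter.eventually_all.2 fun i => ?_
    have : Filter.Tendsto (fun w : AdelesAway F q => w * diagAway q (x i)) (nhds 0) (nhds 0) := by
      simpa using (continuous_mul_const (diagAway q (x i))).tendsto 0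
    exact this.eventually h
  obtain ⟨M, hM0, hM, hMW⟩ := exists_coprime_diagAway_mem hq h1
  refine ⟨M, hM0, hM, fun i y => ?_⟩
  rw [← hMW i (diagAway q y), diagAway_add]
  congr 2
  refine RestrictedProduct.ext _ _ fun v => ?_
  rw [nsmul_eq_mul]
  exact map_mul (algebraMap F (v.1.adicCompletion F)) _ _

theorem exists_mul_mem_integers (a : AdelesAway F q) : ∃ r : 𝓞 F, r ≠ 0 ∧
    ∀ v, a v * algebraMap F (v.1.adicCompletion F) (algebraMap (𝓞 F) F r) ∈ v.1.adicCompletionIntegers F := by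
  classical
  have hr (r : 𝓞 F) (v : FinPlace F) : algebraMap F (v.adicCompletion F) (algebraMap (𝓞 F) F r) ∈ v.adicCompletionIntegers F :=
    v.coe_mem_adicCompletionIntegers r
  choose s hs hsv using fun v : {v : FinPlace F // ¬ Above q v} =>
    HeightOneSpectrum.adicCompletion.mul_nonZeroDivisor_mem_adicCompletionIntegers v.1 (a v)
  have hfin : {v | ¬ a v ∈ (v.1.adicCompletionIntegers F : Set (v.1.adicCompletion F))}.Finite := a.2
  refine ⟨∏ v ∈ hfin.toFinset, s v,
    Finset.prod_ne_zero_iff.2 fun v _ => nonZeroDivisors.ne_zero (hs v), fun v => ?_⟩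
  by_cases hv : v ∈ hfin.toFinset
  · rw [← Finset.mul_prod_erase _ _ hv, map_mul]
    rw [map_mul, ← mul_assoc]
    exact mul_mem (hsv v) (hr _ _)
  · have : a v ∈ v.1.adicCompletionIntegers F := by
      by_contra h
      exact hv (hfin.mem_toFinset.2 h)
    exact mul_mem this (hr _ _)

/-- The support of a Schwartz function away from `q` has bounded denominators. -/
theorem exists_denominator {R : Type*} [CommRing R] {φ : AdelesAway F q → R}
    (hφ : φ ∈ schwartz (AdelesAway F q) R) : ∃ r : 𝓞 F, r ≠ 0 ∧ ∀ y : F, φ (diagAway q y) ≠ 0 →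
      ∀ v : FinPlace F, ¬ Above q v → v.valuation F (algebraMap (𝓞 F) F r * y) ≤ 1 := by
  have hr (r : 𝓞 F) (v : FinPlace F) : algebraMap F (v.adicCompletion F) (algebraMap (𝓞 F) F r) ∈ v.adicCompletionIntegers F :=
    v.coe_mem_adicCompletionIntegers r
  obtain ⟨r, hr0, h⟩ := IsCompact.induction_on hφ.2 (p := fun S => ∃ r : 𝓞 F, r ≠ 0 ∧ ∀ a ∈ S,
      ∀ v, a v * algebraMap F (v.1.adicCompletion F) (algebraMap (𝓞 F) F r) ∈ v.1.adicCompletionIntegers F)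
    ⟨1, one_ne_zero, by simp⟩ (fun s t hst ⟨r, hr0, h⟩ => ⟨r, hr0, fun a ha => h a (hst ha)⟩)
    (fun s t ⟨r, hr0, h⟩ ⟨r', hr0', h'⟩ => ⟨r * r', mul_ne_zero hr0 hr0', by
      rintro a (ha | ha) v
      · rw [map_mul (algebraMap (𝓞 F) F), map_mul, ← mul_assoc]
        exact mul_mem (h a ha v) (hr _ _)
      · rw [mul_comm r, map_mul (algebraMap (𝓞 F) F), map_mul, ← mul_assoc]
        exact mul_mem (h' a ha v) (hr _ _)⟩) (by
    intro a _
    obtain ⟨r, hr0, h⟩ := exists_mul_mem_integers a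
    -- A denominator of `a` also serves a whole neighbourhood, because the integral adeles are open;
    -- compactness of the support then leaves finitely many denominators to multiply.
    refine ⟨{a' | ∀ v, (a' * diagAway q (algebraMap (𝓞 F) F r)).1 v ∈ (v.1.adicCompletionIntegers F : Set _)},
      mem_nhdsWithin_of_mem_nhds ?_, r, hr0, fun a' ha' v => ha' v⟩
    refine ((RestrictedProduct.isOpen_forall_mem isOpen_integers_away.out).preimage
      (continuous_mul_const (diagAway q (algebraMap (𝓞 F) F r)))).mem_nhds ?_
    exact fun v => h v)
  refine ⟨r, hr0, fun y hy v hv => ?_⟩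
  have := h _ (subset_tsupport φ hy) ⟨v, hv⟩
  rw [HeightOneSpectrum.mem_adicCompletionIntegers, diagAway_apply, map_mul,
    valued_algebraMap, valued_algebraMap, mul_comm] at this
  rwa [map_mul]

end Away

end ConeZeta

end

noncomputable section

namespace ConeZeta

/-! ### The residue map and the decomposition of `φ_q` into additive characters -/

/-- From `∑_{j<q} ζ^j = 0` one gets `q = ∑_{j<q} (1 - ζ^j)`, which is `1 - ζ` times a sum of powers
of `ζ`. That sum has norm at most `1` while `q` has norm `1`, so `1 - ζ` has norm at least `1`. -/
theorem norm_inv_one_sub_le_one {K : Type*} [NormedField K] [IsUltrametricDist K] {q : ℕ}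
    (hq : 0 < q) (hqK : ‖(q : K)‖ = 1) {ζ : K} (hζ : ζ ^ q = 1) (hζ1 : ζ ≠ 1) :
    ‖(1 - ζ)⁻¹‖ ≤ 1 := by
  have hne : 1 - ζ ≠ 0 := sub_ne_zero.2 hζ1.symm
  have hnorm : ‖ζ‖ ≤ 1 := (pow_le_one_iff_of_nonneg (norm_nonneg _) hq.ne').1 (by
    rw [← norm_pow, hζ, norm_one])
  have h0 : ∑ j ∈ Finset.range q, ζ ^ j = 0 := by
    have := mul_neg_geom_sum ζ q
    rw [hζ, sub_self] at this
    exact (mul_eq_zero.1 this).resolve_left hne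
  have h1 : (q : K) = (1 - ζ) * ∑ j ∈ Finset.range q, ∑ i ∈ Finset.range j, ζ ^ i := by
    simp only [Finset.mul_sum (Finset.range q), mul_neg_geom_sum, Finset.sum_sub_distrib, h0]
    simp
  have h2 : ‖∑ j ∈ Finset.range q, ∑ i ∈ Finset.range j, ζ ^ i‖ ≤ 1 :=
    IsUltrametricDist.norm_sum_le_of_forall_le_of_nonneg zero_le_one fun j _ =>
      IsUltrametricDist.norm_sum_le_of_forall_le_of_nonneg zero_le_one fun i _ => by
        rw [norm_pow]
        exact pow_le_one₀ (norm_nonneg _) hnorm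
  rw [norm_inv]
  refine inv_le_one_of_one_le₀ ?_
  rw [← hqK, h1, norm_mul]
  exact mul_le_of_le_one_right (norm_nonneg _) h2

theorem norm_natCast_padicComplex_eq_one {p q : ℕ} [Fact p.Prime] (h : p.Coprime q) :
    ‖(q : ℂ_[p])‖ = 1 := by
  have := PadicComplex.norm_extends' p (q : ℚ_[p])
  rw [Padic.norm_natCast_eq_one_iff.2 h] at this
  simpa using this

section Residue

variable {F : Type*} [Field F] [NumberField F] {q : ℕ}

/-- At a place with residue field of prime order `q`, there is a residue map to `ZMod q`. -/
theorem exists_residue (hq : q.Prime) (v : FinPlace F) (hv : Ideal.absNorm v.asIdeal = q) :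
    ∃ res : F → ZMod q, ∀ y, v.valuation F y ≤ 1 → ∀ k : ℤ,
      v.valuation F (y - k) < 1 ↔ (k : ZMod q) = res y := by
  have hcard : Nat.card (𝓞 F ⧸ v.asIdeal) = q := by
    rw [← hv, Ideal.absNorm_apply, Submodule.cardQuot_apply]
  have hfin : Finite (𝓞 F ⧸ v.asIdeal) := Nat.finite_of_card_ne_zero (hcard ▸ hq.ne_zero)
  have := Fintype.ofFinite (𝓞 F ⧸ v.asIdeal)
  let e : ZMod q ≃+* 𝓞 F ⧸ v.asIdeal :=
    ZMod.ringEquivOfPrime _ hq (by rw [← Nat.card_eq_fintype_card, hcard])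
  have hint (k : ℤ) (a : 𝓞 F) : v.valuation F (algebraMap (𝓞 F) F a - k) < 1 ↔
      (k : ZMod q) = e.symm (Ideal.Quotient.mk _ a) := by
    have h1 : algebraMap (𝓞 F) F a - k = algebraMap (𝓞 F) F (a - k) := by simp
    rw [h1, v.valuation_lt_one_iff_mem, ← Ideal.Quotient.eq_zero_iff_mem, map_sub, sub_eq_zero,
      RingEquiv.eq_symm_apply, map_intCast, map_intCast]
    exact eq_comm
  have hex (y : F) (hy : v.valuation F y ≤ 1) :
      ∃ a : 𝓞 F, v.valuation F (algebraMap (𝓞 F) F a - y) < 1 := by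
    simpa using v.exists_valuation_sub_lt_of_integer hy 1
  choose! a ha using hex
  refine ⟨fun y => e.symm (Ideal.Quotient.mk _ (a y)), fun y hy k => ?_⟩
  rw [← hint]
  constructor
  · intro h
    have := Valuation.map_add_lt _ (ha y hy) h
    rwa [sub_add_sub_cancel] at this
  · intro h
    have := Valuation.map_add_lt _ (by rw [Valuation.map_sub_swap]; exact ha y hy) h
    rwa [sub_add_sub_cancel] at this

theorem residue_eq_zero_iff {v : FinPlace F} {res : F → ZMod q}
    (hres : ∀ y, v.valuation F y ≤ 1 → ∀ k : ℤ,
      v.valuation F (y - k) < 1 ↔ (k : ZMod q) = res y)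
    {y : F} (hy : v.valuation F y ≤ 1) : res y = 0 ↔ v.valuation F y < 1 := by
  have := hres y hy 0
  rw [Int.cast_zero, Int.cast_zero, sub_zero] at this
  rw [this, eq_comm]

/-- Integers approximating `y` and `z` modulo the prime add up to one approximating `y + z`. Nothing
is claimed outside the valuation ring, where `res` carries no information. -/
theorem residue_add {v : FinPlace F} {res : F → ZMod q}
    (hres : ∀ y, v.valuation F y ≤ 1 → ∀ k : ℤ,
      v.valuation F (y - k) < 1 ↔ (k : ZMod q) = res y)
    {y z : F} (hy : v.valuation F y ≤ 1) (hz : v.valuation F z ≤ 1) :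
    res (y + z) = res y + res z := by
  obtain ⟨k, hk⟩ := ZMod.intCast_surjective (res y)
  obtain ⟨l, hl⟩ := ZMod.intCast_surjective (res z)
  rw [← hk, ← hl, ← Int.cast_add, eq_comm, ← hres _ (Valuation.map_add_le _ hy hz)]
  have := Valuation.map_add_lt _ ((hres y hy k).2 hk) ((hres z hz l).2 hl)
  rwa [sub_add_sub_comm, ← Int.cast_add] at this

/-- The residue map and additive characters decompose `φ ⊗ φ_q` on `F` into functions which are
quasi-periodic under translation by units at `q`. -/
def charTerm (q : ℕ) (φ : AdelesAway F q → Qbar) (ψ : AddChar (ZMod q) Qbar) (res : F → ZMod q)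
    (k : ZMod q) (y : F) : Qbar :=
  open Classical in
  if ∀ v : FinPlace F, Above q v → v.valuation F y ≤ 1 then -(φ (diagAway q y) * ψ (k * res y)) else 0

/-- Orthogonality gives `∑_k ψ(k r) = q · 1_{r = 0}`; removing `k = 0` and changing sign yields `1`
on units and `1 - q` on the maximal ideal. Off the integral elements both sides vanish. -/
theorem tensor_phiQ_eq_sum [Fact q.Prime] (𝔮 : {v : FinPlace F // Above q v})
    (h𝔮 : Ideal.absNorm 𝔮.1.asIdeal = q) (φ : AdelesAway F q → Qbar) {ψ : AddChar (ZMod q) Qbar}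
    (hψ : ψ.IsPrimitive) {res : F → ZMod q}
    (hres : ∀ y, 𝔮.1.valuation F y ≤ 1 → ∀ k : ℤ,
      𝔮.1.valuation F (y - k) < 1 ↔ (k : ZMod q) = res y) (y : F) :
    tensor φ (phiQ Qbar 𝔮) (algebraMap F _ y) =
      ∑ k ∈ Finset.univ.erase (0 : ZMod q), charTerm q φ ψ res k y := by
  classical
  have hval (v : {v : FinPlace F // Above q v}) :
      Valued.v (localPart q (algebraMap F (FiniteAdeleRing (𝓞 F) F) y) v) = v.1.valuation F y :=
    valued_algebraMap v.1 y
  have htensor : tensor φ (phiQ Qbar 𝔮) (algebraMap F _ y) =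
    φ (diagAway q y) * phiQ Qbar 𝔮 (localPart q (algebraMap F _ y)) := rfl
  rw [htensor, phiQ, phiPrime, hval, h𝔮]
  simp only [HeightOneSpectrum.mem_adicCompletionIntegers, hval]
  unfold charTerm
  by_cases hy : ∀ v : FinPlace F, Above q v → v.valuation F y ≤ 1
  · have h𝔮y := hy 𝔮.1 𝔮.2
    simp only [if_pos hy]
    have hy' : ∀ v : {v : FinPlace F // Above q v}, v ≠ 𝔮 → v.1.valuation F y ≤ 1 :=
      fun v _ => hy v.1 v.2
    rw [if_pos hy', Finset.sum_neg_distrib, ← Finset.mul_sum,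
      Finset.sum_erase_eq_sub (Finset.mem_univ _), AddChar.sum_mulShift _ hψ, zero_mul,
      AddChar.map_zero_eq_one, ZMod.card]
    by_cases h : 𝔮.1.valuation F y < 1
    · rw [if_neg h.ne, if_pos h, if_pos ((residue_eq_zero_iff hres h𝔮y).2 h)]
      ring
    · rw [if_pos (le_antisymm h𝔮y (not_lt.1 h)),
        if_neg (mt (residue_eq_zero_iff hres h𝔮y).1 h)]
      simp
  · simp only [if_neg hy, Finset.sum_const_zero]
    refine mul_eq_zero_of_right _ ?_
    by_cases h : ∀ v, v ≠ 𝔮 → v.1.valuation F y ≤ 1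
    · have h2 : ¬ 𝔮.1.valuation F y ≤ 1 := fun h2 => hy fun v hv => by
        by_cases e : (⟨v, hv⟩ : {v : FinPlace F // Above q v}) = 𝔮
        · rw [← e] at h2
          exact h2
        · exact h ⟨v, hv⟩ e
      rw [if_pos h, if_neg fun h3 => h2 h3.le, if_neg fun h3 => h2 h3.le]
    · rw [if_neg h]

/-- As `z` is integral above `q`, translation by it preserves both integrality and its failure
there; on integral elements the residue is additive, and `ψ` turns this into a constant factor. -/
theorem charTerm_add {φ : AdelesAway F q → Qbar} {ψ : AddChar (ZMod q) Qbar} {res : F → ZMod q}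
    (𝔮 : {v : FinPlace F // Above q v})
    (hres : ∀ y, 𝔮.1.valuation F y ≤ 1 → ∀ k : ℤ,
      𝔮.1.valuation F (y - k) < 1 ↔ (k : ZMod q) = res y) {z : F}
    (hz : ∀ v : FinPlace F, Above q v → v.valuation F z = 1)
    (hφ : ∀ y, φ (diagAway q (y + z)) = φ (diagAway q y)) (k : ZMod q) (y : F) :
    charTerm q φ ψ res k (y + z) = ψ (k * res z) * charTerm q φ ψ res k y := by
  unfold charTerm
  by_cases hy : ∀ v : FinPlace F, Above q v → v.valuation F y ≤ 1
  · rw [if_pos hy, if_pos fun v hv => Valuation.map_add_le _ (hy v hv) (hz v hv).le, hφ,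
      residue_add hres (hy _ 𝔮.2) (hz _ 𝔮.2).le, mul_add, AddChar.map_add_eq_mul]
    ring
  · rw [if_neg hy, if_neg, mul_zero]
    refine fun h => hy fun v hv => ?_
    have := Valuation.map_sub_le (v.valuation F) (h v hv) (hz v hv).le
    rwa [add_sub_cancel_right] at this

/-- Nonvanishing forces integrality above `q` and bounded denominators elsewhere, so some fixed `r
y` is integral and `y` ranges over a bounded cell. -/
theorem finite_charTerm_ne_zero [IsTotallyReal F] {φ : AdelesAway F q → Qbar}
    (hφ : φ ∈ schwartz (AdelesAway F q) Qbar) (ψ : AddChar (ZMod q) Qbar) (res : F → ZMod q)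
    (k : ZMod q) {m : ℕ} (x : Fin m → F) :
    {y | realEmb y ∈ halfOpenCell x Set.univ ∧ charTerm q φ ψ res k y ≠ 0}.Finite := by
  obtain ⟨r, hr0, hr⟩ := exists_denominator hφ
  have hr0' : algebraMap (𝓞 F) F r ≠ 0 := by simpa using hr0
  refine (finite_mem_halfOpenCell x hr0').subset fun y hy => ⟨hy.1, ?_⟩
  have h2 := hy.2
  unfold charTerm at h2
  split_ifs at h2 with hint
  · have h3 : φ (diagAway q y) ≠ 0 := fun h => h2 (by rw [h, zero_mul, neg_zero])
    obtain ⟨a, ha⟩ := HeightOneSpectrum.mem_integers_of_valuation_le_one F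
      (algebraMap (𝓞 F) F r * y) fun (v : FinPlace F) => by
        by_cases hv : Above q v
        · rw [map_mul]
          exact mul_le_one' (HeightOneSpectrum.valuation_le_one (K := F) v r) (hint v hv)
        · exact hr y h3 v hv
    rw [← ha]
    exact RingOfIntegers.isIntegral_coe (K := F) a
  · exact (h2 rfl).elim

end Residue

end ConeZeta

end

/-! ### Assembly over the nontrivial characters. -/

theorem lemma4p1 {F : Type*} [Field F] [NumberField F] [IsTotallyReal F]
    {κ : Type*} (b : Module.Basis κ Qbar (Qbar ⊗[ℚ] F))
    (p q : ℕ) [Fact p.Prime] (hq : q.Prime) (hqp : q ≠ p)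
    (ιp : Qbar →+* ℂ_[p]) (ιc : Qbar →+* ℂ)
    (𝔮 : {v : FinPlace F // Above q v}) (h𝔮 : Ideal.absNorm 𝔮.1.asIdeal = q)
    (φ : AdelesAway F q → Qbar) (hφ : φ ∈ schwartz (AdelesAway F q) Qbar)
    {m : ℕ} (x : Fin m → F) (hx : GeneratesShintaniCone x) (hxq : ∀ i, MemEPlus q (x i)) :
    ∃ ψ : SeriesRing κ,
      solomonHu b (Set.indicator (shintaniCone x) 1) (tensor φ (phiQ Qbar 𝔮)) =
        algebraMap (SeriesRing κ) (SeriesField κ) ψ ∧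
      ‖ιp (MvPowerSeries.constantCoeff ψ)‖ ≤ maxNorm ιp φ ∧
      (∀ s : ℂ, (m : ℝ) / Module.finrank ℚ F < s.re →
        Summable fun y : F => ‖coneTerm ιc (tensor φ (phiQ Qbar 𝔮)) (shintaniCone x) s y‖) ∧
      ∃ L : ℂ → ℂ, Differentiable ℂ L ∧
        (∀ s : ℂ, (m : ℝ) / Module.finrank ℚ F < s.re →
          HasSum (coneTerm ιc (tensor φ (phiQ Qbar 𝔮)) (shintaniCone x) s) (L s)) ∧
        L 0 = ιc (MvPowerSeries.constantCoeff ψ) := by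
  classical
  have hqfact : Fact q.Prime := ⟨hq⟩
  have hqQ : NeZero ((q : ℕ) : Qbar) := ⟨Nat.cast_ne_zero.2 hq.ne_zero⟩
  obtain ⟨M, hM0, hM, hMφ⟩ := exists_coprime_forall_add_eq hq hφ x
  obtain ⟨res, hres⟩ := exists_residue hq 𝔮.1 h𝔮
  obtain ⟨ζ, hζ⟩ := HasEnoughRootsOfUnity.exists_primitiveRoot Qbar q
  set χ : AddChar (ZMod q) Qbar := AddChar.zmodChar q hζ.pow_eq_one with hχdef
  have hχ : χ.IsPrimitive := AddChar.zmodChar_primitive_of_primitive_root q hζ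
  have hχq (a : ZMod q) : χ a ^ q = 1 := by
    rw [← AddChar.map_nsmul_eq_pow, nsmul_eq_mul, CharP.cast_eq_zero, zero_mul,
      AddChar.map_zero_eq_one]
  -- Rescaling the generators leaves the cone unchanged, and `M` prime to `q` keeps them units above
  -- `q`.
  set z : Fin m → F := fun i => M • x i with hz
  have hzC : shintaniCone x = shintaniCone z := (shintaniCone_nsmul x hM0).symm
  have hzg : GeneratesShintaniCone z := hx.nsmul hM0
  have hz1 (i : Fin m) (v : FinPlace F) (hv : Above q v) : v.valuation F (z i) = 1 := by
    rw [hz]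
    dsimp only
    rw [nsmul_eq_mul, map_mul, valuation_natCast_eq_one hv hM, (hxq i).2.1 v hv, one_mul]
  set g : ZMod q → F → Qbar := charTerm q φ χ res with hg
  set c : ZMod q → Fin m → Qbar := fun k i => χ (k * res (z i)) with hc
  have hgper (k : ZMod q) (i : Fin m) (y : F) : g k (y + z i) = c k i * g k y :=
    charTerm_add 𝔮 hres (hz1 i) (hMφ i) k y
  -- A primitive character is injective at `0`, and `k res(z_i)` is a product of two nonzero
  -- elements of the field `ZMod q`.
  have hc1 (k : ZMod q) (hk : k ≠ 0) (i : Fin m) : c k i ≠ 1 := by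
    rw [hc, Ne, AddChar.IsPrimitive.zmod_char_eq_one_iff q hχ, mul_eq_zero, not_or]
    refine ⟨hk, fun h => ?_⟩
    have h1 := hz1 i 𝔮.1 𝔮.2
    exact absurd ((residue_eq_zero_iff hres h1.le).1 h) h1.not_lt
  set D : ZMod q → Finset F := fun k => (finite_charTerm_ne_zero hφ χ res k z).toFinset with hDdef
  have hD (k : ZMod q) (y : F) : y ∈ D k ↔ realEmb y ∈ halfOpenCell z Set.univ ∧ g k y ≠ 0 :=
    Set.Finite.mem_toFinset _
  set S : Finset (ZMod q) := Finset.univ.erase 0 with hS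
  have hS0 (k : ZMod q) (hk : k ∈ S) : k ≠ 0 := (Finset.mem_erase.1 hk).1
  have hΦ (y : F) : tensor φ (phiQ Qbar 𝔮) (algebraMap F _ y) = ∑ k ∈ S, g k y :=
    tensor_phiQ_eq_sum 𝔮 h𝔮 φ hχ hres y
  have hformal (k : ZMod q) (hk : k ∈ S) := exists_foldr_diffOp_eq b hzg.linearIndependent (hgper k)
    hq.pos (fun i => hχq _) (hc1 k (hS0 k hk)) (D k) (hD k)
  have hanalytic (k : ZMod q) (hk : k ∈ S) := exists_entire_twisted hzg (hgper k)
    hq.pos (fun i => hχq _) (hc1 k (hS0 k hk)) (D k) (hD k) ιc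
  choose! h hfold hexp using hformal
  choose! L hL hLs hL0 using hanalytic
  have hsum (s : ℂ) (hs : (m : ℝ) / Module.finrank ℚ F < s.re) :
      HasSum (coneTerm ιc (tensor φ (phiQ Qbar 𝔮)) (shintaniCone x) s) (∑ k ∈ S, L k s) := by
    have e : coneTerm ιc (tensor φ (phiQ Qbar 𝔮)) (shintaniCone x) s = fun y => ∑ k ∈ S,
        ιc (g k y) * (if realEmb y ∈ shintaniCone z then 1 else 0) *
          ((Algebra.norm ℚ y : ℚ) : ℂ) ^ (-s) := by
      ext y
      rw [coneTerm, hΦ, map_sum, Finset.sum_mul, Finset.sum_mul, hzC]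
    rw [e]
    exact hasSum_sum fun k hk => hLs k hk s hs
  refine ⟨∑ k ∈ S, twistedSeries b z (g k) (c k) (D k), ?_, ?_, fun s hs => (hsum s hs).summable.norm,
    fun s => ∑ k ∈ S, L k s, Differentiable.fun_sum fun k hk => hL k hk, hsum, ?_⟩
  · apply solomonHu_eq
    -- The same steps `q z_i` regularise every `g_k`, so the finitely supported functions and the
    -- numerators simply add up over `k`.
    refine ⟨(List.finRange m).map fun i => q • z i, ?_, ∑ k ∈ S, h k, ?_, ?_⟩
    · simp only [List.mem_map, List.mem_finRange, true_and, forall_exists_index,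
        forall_apply_eq_imp_iff]
      intro i h0
      have h1 := (hzg.nsmul hq.pos).totallyPositive i (Classical.arbitrary _)
      rw [h0, map_zero] at h1
      exact h1.ne rfl
    · have e : (fun y => ((Set.indicator (shintaniCone x) 1 (realEmb y) : ℤ) : Qbar) *
          tensor φ (phiQ Qbar 𝔮) (algebraMap F _ y)) =
          ∑ k ∈ S, fun y => if realEmb y ∈ shintaniCone z then g k y else 0 := by
        ext y
        rw [Finset.sum_apply, hΦ, hzC]
        by_cases hy : realEmb y ∈ shintaniCone z <;> simp [hy]
      rw [e, foldr_diffOp_sum, Finsupp.coe_finsetSum]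
      exact Finset.sum_congr rfl hfold
    · rw [← expSum_apply, map_sum (expSum b), ← map_mul, Finset.mul_sum]
      congr 1
      exact Finset.sum_congr rfl hexp
  · have hmax : 0 ≤ maxNorm ιp φ := Real.iSup_nonneg fun _ => norm_nonneg _
    have hqp' : ‖(q : ℂ_[p])‖ = 1 :=
      norm_natCast_padicComplex_eq_one ((Nat.coprime_primes Fact.out hq).2 hqp.symm)
    have hgp (k : ZMod q) (y : F) : ‖ιp (g k y)‖ ≤ maxNorm ιp φ := by
      rw [hg, charTerm]
      split_ifs
      -- Character values are roots of unity, so twisting by them does not change the `p`-adic size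
      -- of `φ`.
      · have h1 : ‖ιp (χ (k * res y))‖ = 1 := (pow_eq_one_iff_of_nonneg (norm_nonneg _) hq.ne_zero).1
          (by rw [← norm_pow, ← map_pow, hχq, map_one, norm_one])
        rw [map_neg, norm_neg, map_mul, norm_mul, h1, mul_one]
        exact norm_le_maxNorm ιp hφ _
      · rw [map_zero, norm_zero]
        exact hmax
    rw [map_sum, map_sum]
    refine IsUltrametricDist.norm_sum_le_of_forall_le_of_nonneg hmax fun k hk => ?_
    rw [constantCoeff_twistedSeries, map_mul, map_prod, norm_mul, norm_prod, map_sum]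
    refine (mul_le_mul
      (IsUltrametricDist.norm_sum_le_of_forall_le_of_nonneg hmax fun y _ => hgp k y)
      (Finset.prod_le_one (fun _ _ => norm_nonneg _) fun i _ => ?_)
      (Finset.prod_nonneg fun _ _ => norm_nonneg _) hmax).trans_eq (mul_one _)
    rw [map_inv₀, map_sub, map_one]
    refine norm_inv_one_sub_le_one hq.pos hqp' (by rw [← map_pow, hχq, map_one]) fun h1 => ?_
    exact hc1 k (hS0 k hk) i (ιp.injective (by rw [h1, map_one]))
  · rw [map_sum, map_sum]
    refine Finset.sum_congr rfl fun k hk => ?_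
    rw [hL0 k hk, constantCoeff_twistedSeries]
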